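/- For integers $k\ge 1$ and $n\ge 0$, let $T_k(n)$ be the Turán graph, i.e. the complete balanced $k$-partite graph on $n$ vertices, and $t_k(n)$ its number of edges. For integers $r\ge 3$ and $0\le m\le n$ put $$t_{r-1}(n,m)=\begin{cases} t_{r-1}(n) & \text{if } n\le (r-1)m,\\ \binom n2-nm+(r-1)\binom{m+1}{2} & \text{otherwise,}\end{cases}$$ and define a family $\mathrm{Tur}_{r-1}(n,m)$ of $n$-vertex graphs, closed under isomorphism, as follows. If $n\le (r-1)m$, its only member (up to isomorphism) is $T_{r-1}(n)$. If $n>(r-1)m$, take $T_{r-1}((r-1)m)$ with colour classes $V_1,\dots,V_{r-1}$ and an arbitrary $m$-set $M'\subseteq V_1\cup\dots\cup V_{r-1}$; add new vertices $v_1,\dots,v_{r-1}$ and a set $Y$ of $n-(r-1)m$ further new vertices, such that each $v_i$ is adjacent to all old and new vertices except those in $V_i$ and itself, and each $y\in Y$ is adjacent to all old and new vertices except those in $M'$ and itself. The family consists of all $n$-vertex graphs obtained from such a graph (for some choice of $M'$) by deleting any $r-1$ vertices from $\{v_1,\dots,v_{r-1}\}\cup Y$. Theorem. For every $r\ge 3$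 and $\varepsilon>0$ there is $\gamma>0$ such that the following holds. Let $m\le n$, let $G$ be any $n$-vertex graph and let $M\subseteq V(G)$ be a set of $m$ vertices such that no copy of $K_r$ in $G$ contains a vertex of $M$. If $e(G)>t_{r-1}(n,m)-\gamma n^2$, then there is a graph $H$ on the vertex set $V(G)$ which belongs to $\mathrm{Tur}_{r-1}(n,m)$, such that no copy of $K_r$ in $H$ contains a vertex of the same set $M$, and such that $H$ can be obtained from $G$ by deleting and inserting at most $\varepsilon n^2$ edges in total. -/

import Mathlib

namespace TuranMeet

/-- `tur k n` is the number of edges of the Turán graph, the complete balanced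
`k`-partite graph on `n` vertices. -/
def tur (k n : ℕ) : ℕ := (SimpleGraph.turanGraph n k).edgeFinset.card

/-- The extremal number `t_k(n, m)` (with `k = r - 1`); an integer, so that the subtraction is
the true one. -/
def turm (k n m : ℕ) : ℤ :=
  if n ≤ k * m then (tur k n : ℤ)
  else (n.choose 2 : ℤ) - (n : ℤ) * (m : ℤ) + (k : ℤ) * ((m + 1).choose 2 : ℤ)

/-- Adjacency in the graph `G_r(n, M)`, `k = r - 1`. The vertices are
* the `k * m` old vertices, carrying the Turán graph, whose `i`-th colour class `V_i` consists of
  the `u` with `u % k = i`; the set `M` is a set of old vertices;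
* `k` sporadic vertices `v_i`, where `v_i` is adjacent to everything except `V_i` and itself;
* the `n - k * m` vertices of `Y`, each adjacent to everything except `M` and itself. -/
def bigAdj (k n m : ℕ) (M : Finset (Fin (k * m))) :
    Fin (k * m) ⊕ (Fin k ⊕ Fin (n - k * m)) → Fin (k * m) ⊕ (Fin k ⊕ Fin (n - k * m)) → Prop
  | .inl u, .inl w => (SimpleGraph.turanGraph (k * m) k).Adj u w
  | .inl u, .inr (.inl i) => (u : ℕ) % k ≠ (i : ℕ)
  | .inr (.inl i), .inl u => (u : ℕ) % k ≠ (i : ℕ)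
  | .inl u, .inr (.inr _) => u ∉ M
  | .inr (.inr _), .inl u => u ∉ M
  | .inr a, .inr b => a ≠ b

/-- The graph `G_r(n, M)` on `n + r - 1` vertices, `k = r - 1`, used for `k * m < n`. -/
def bigGraph (k n m : ℕ) (M : Finset (Fin (k * m))) :
    SimpleGraph (Fin (k * m) ⊕ (Fin k ⊕ Fin (n - k * m))) where
  Adj := bigAdj k n m M
  symm := by
    refine ⟨?_⟩
    rintro (u | i | y) (w | j | z) h
    · exact SimpleGraph.Adj.symm (G := SimpleGraph.turanGraph (k * m) k) h
    all_goals simp_all [bigAdj, eq_comm]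
  loopless := by
    refine ⟨?_⟩
    rintro (u | i | y) h <;> simp_all [bigAdj]

/-- `H` belongs, up to isomorphism, to the family `Tur_k(n, m)`, where `n` is the number of
vertices of `H`: if `n ≤ k * m` it is the Turán graph; otherwise it arises from some `G_r(n, M)`,
with `M` any `m`-set of old vertices, by deleting a set `D` of exactly `k = r - 1` vertices among
the sporadic ones and those of `Y`. -/
def IsTurm {V : Type*} [Fintype V] (k m : ℕ) (H : SimpleGraph V) : Prop :=
  if Fintype.card V ≤ k * m then
    Nonempty (H ≃g SimpleGraph.turanGraph (Fintype.card V) k)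
  else
    ∃ M : Finset (Fin (k * m)), M.card = m ∧
      ∃ D : Finset (Fin k ⊕ Fin (Fintype.card V - k * m)), D.card = k ∧
        Nonempty (H ≃g (bigGraph k (Fintype.card V) m M).induce
          {x | ∀ d ∈ D, x ≠ Sum.inr d})

/-- No copy of `K_r` in `G` meets `M`. -/
def NoCliqueMeets {V : Type*} (G : SimpleGraph V) (r : ℕ) (M : Finset V) : Prop :=
  ∀ s : Finset V, G.IsNClique r s → Disjoint s M

/-- The number of edges that have to be deleted or inserted to turn `G` into `H`, two graphs on
the same vertex set (no relabelling). -/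
noncomputable def editDist {V : Type*} (G H : SimpleGraph V) : ℕ :=
  (symmDiff G.edgeSet H.edgeSet).ncard

end TuranMeet

/-!
Write `k = r - 1`, `n = |V|`, `m = |M|`. The statement combines an exact theorem, which settles the
case that `n` is bounded in terms of `ε`, with a stability theorem for large `n`. Edges are counted
twice, as ordered pairs of adjacent vertices (`adjPairs`), and compared with the polynomial
`twoTurm k n m = n (n - 1) - 2 n m + k m (m + 1)`. Twice the extremal
number is the value of this polynomial at `(n, m)` if `k m < n`, and at `(n, ⌊n / k⌋)` otherwise. In
the latter case `M` may be replaced by a subset with `⌊n / k⌋` vertices, so that only `k m ≤ n` has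
to be treated.

*Upper bound* (`NoCliqueMeets.adjPairs_le`). If all vertices outside `M` have at most `m`
non-neighbours (counting themselves), then a vertex of `M` with more than `(k - 1) m` neighbours
extends greedily to a `(k + 1)`-clique. Hence there is a vertex outside `M` of degree at most
`n - 1 - m`, or one in `M` of degree at most `(k - 1) m`; deleting it, one concludes by induction.

*Equality* (`NoCliqueMeets.exists_isBlockColoring`). For `n > k m` the degree sum shows that there
is a vertex outside `M` of degree `n - 1 - m`, and it can be put back into the structure found
by induction after its deletion. For `n = k m` the graph is regular, and the non-neighbourhoods of
the vertices of a `k`-clique meeting `M` partition it. The structure is recorded by a partial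
`k`-colouring (`blockGraph`, `IsBlockColoring`).

*Stability* (`NoCliqueMeets.exists_coloring`). Applied to `G` minus a few vertices of low degree,
the upper bound shows that almost all vertices have degree at least `n - m` or `(k - 1) m`,
up to a small error `Δ`. Choose a clique consisting of `v ∈ M` and a set `S` of `k - 1`
typical vertices outside `M`. Each of these has about `m` non-neighbours, and every neighbour of `v`
has a non-neighbour in `S`, so the non-neighbourhoods of the vertices of `S` are almost disjoint
and almost independent. A vertex of `M` outside their union `W` only has neighbours in `W`. Thus,
if almost all of `M` lies outside `W`, it is the missing colour class. Otherwise a typical vertex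
of `M ∩ W` leads to a further typical vertex `a₁ ∉ M` complete to `S`, and the
non-neighbourhoods of the vertices of the `k`-clique `insert a₁ S` are the `k` colour classes
(`NoCliqueMeets.exists_isApproxColoring`). After recolouring a few vertices, the classes have
exactly `m` vertices, and the resulting block graph `H` contains all edges of `G` but those at few
vertices. As `H` obeys the upper bound and `G` almost attains it, `H` cannot have many further edges.
-/

namespace TuranMeet

open Finset

section

variable {V : Type*} [DecidableEq V] {G : SimpleGraph V} [DecidableRel G.Adj]

/-! ### Degrees, greedy cliques and doubled edge counts inside a vertex set -/

/-- The neighbours of `x` that lie in `T`. -/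
def nbrs (G : SimpleGraph V) [DecidableRel G.Adj] (T : Finset V) (x : V) : Finset V :=
  {y ∈ T | G.Adj x y}

/-- The non-neighbours of `x` that lie in `T`; a vertex of `T` counts as its own non-neighbour. -/
def conbrs (G : SimpleGraph V) [DecidableRel G.Adj] (T : Finset V) (x : V) : Finset V :=
  {y ∈ T | ¬ G.Adj x y}

/-- The number of ordered pairs of adjacent vertices in `T`, twice the number of edges of `G`
inside `T`. -/
def adjPairs (G : SimpleGraph V) [DecidableRel G.Adj] (T : Finset V) : ℕ :=
  ∑ x ∈ T, #(nbrs G T x)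

/-- Twice the polynomial `(n choose 2) - n m + k ((m + 1) choose 2)`, for all integers. -/
def twoTurm (k n m : ℤ) : ℤ := n * (n - 1) - 2 * n * m + k * m * (m + 1)

omit [DecidableEq V] in
lemma mem_nbrs {T : Finset V} {x y : V} : y ∈ nbrs G T x ↔ y ∈ T ∧ G.Adj x y := by
  simp [nbrs]

omit [DecidableEq V] in
lemma mem_conbrs {T : Finset V} {x y : V} : y ∈ conbrs G T x ↔ y ∈ T ∧ ¬ G.Adj x y := by
  simp [conbrs]

omit [DecidableEq V] in
lemma card_nbrs_add_card_conbrs (T : Finset V) (x : V) :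
    #(nbrs G T x) + #(conbrs G T x) = #T :=
  card_filter_add_card_filter_not _

lemma adjPairs_erase {T : Finset V} {x : V} (hx : x ∈ T) :
    adjPairs G T = adjPairs G (T.erase x) + 2 * #(nbrs G T x) := by
  have h1 : ∀ y ∈ T.erase x,
      #(nbrs G T y) = #(nbrs G (T.erase x) y) + if G.Adj x y then 1 else 0 := by
    intro y _
    have : nbrs G (T.erase x) y = (nbrs G T y).erase x := by
      ext z; simp only [mem_nbrs, mem_erase]; tauto
    rw [this]
    split_ifs with h
    · exact (card_erase_add_one (mem_nbrs.2 ⟨hx, h.symm⟩)).symm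
    · rw [erase_eq_of_notMem]
      · rfl
      · exact fun h' => h (mem_nbrs.1 h').2.symm
  have h2 : nbrs G T x = {y ∈ T.erase x | G.Adj x y} := by
    ext z
    simp only [mem_nbrs, mem_filter, mem_erase]
    exact ⟨fun h => ⟨⟨h.2.ne', h.1⟩, h.2⟩, fun h => ⟨h.1.2, h.2⟩⟩
  unfold adjPairs
  rw [← add_sum_erase T _ hx, sum_congr rfl h1, sum_add_distrib, sum_boole, ← h2]
  simp only [Nat.cast_id]
  ring

omit [DecidableEq V] in
lemma adjPairs_add_card_le (T : Finset V) : adjPairs G T + #T ≤ #T * #T := by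
  have h : ∀ x ∈ T, #(nbrs G T x) + 1 ≤ #T := fun x hx => by
    have := card_nbrs_add_card_conbrs (G := G) T x
    have : 0 < #(conbrs G T x) := card_pos.2 ⟨x, mem_conbrs.2 ⟨hx, G.irrefl⟩⟩
    omega
  have := sum_le_sum h
  rw [sum_add_distrib, sum_const, sum_const] at this
  simpa [adjPairs] using this

omit [DecidableEq V] in
lemma adjPairs_univ [Fintype V] : adjPairs G univ = 2 * G.edgeSet.ncard := by
  classical
  rw [← SimpleGraph.coe_edgeFinset, Set.ncard_coe_finset,
    ← SimpleGraph.sum_degrees_eq_twice_card_edges]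
  refine sum_congr rfl fun x _ => ?_
  rw [← SimpleGraph.card_neighborFinset_eq_degree]
  congr 1
  ext y; simp [mem_nbrs]

/-- Greedy choice: as long as `R` is not used up, pick a vertex of `A` and pass to its neighbours
in `R`, which costs at most `D` vertices. -/
lemma exists_isNClique_of_card_conbrs_le {A : Finset V} {D : ℕ} (j : ℕ) :
    ∀ R : Finset V, (∀ a ∈ A, #(conbrs G R a) ≤ D) →
      (j ≠ 0 → #(R \ A) + j * D < #R + D) → ∃ S ⊆ R ∩ A, G.IsNClique j S := by
  induction j with
  | zero => exact fun R _ _ => ⟨∅, by simp, by simp [SimpleGraph.isNClique_iff]⟩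
  | succ j ih =>
    intro R hD hR
    have hR := hR (by omega)
    rw [add_mul, one_mul] at hR
    obtain ⟨a, ha⟩ : (R ∩ A).Nonempty := by
      rw [← card_pos]
      have := card_sdiff_add_card_inter R A
      omega
    rw [mem_inter] at ha
    obtain ⟨S, hS, hc⟩ := ih (nbrs G R a)
      (fun b hb => (card_le_card (filter_subset_filter _ (filter_subset _ _))).trans (hD b hb))
      (fun _ => by
        have h1 : #(nbrs G R a \ A) ≤ #(R \ A) :=
          card_le_card (sdiff_subset_sdiff (filter_subset _ _) subset_rfl)
        have h2 := card_nbrs_add_card_conbrs (G := G) R a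
        have h3 := hD a ha.2
        omega)
    refine ⟨insert a S, ?_, hc.insert fun b hb => (mem_nbrs.1 (mem_inter.1 (hS hb)).1).2⟩
    intro b hb
    rcases mem_insert.1 hb with rfl | hb
    · exact mem_inter.2 ha
    · have := mem_inter.1 (hS hb)
      exact mem_inter.2 ⟨(mem_nbrs.1 this.1).1, this.2⟩

omit [DecidableEq V] [DecidableRel G.Adj] in
lemma NoCliqueMeets.mono {r : ℕ} {M M' : Finset V} (h : NoCliqueMeets G r M) (hM : M' ⊆ M) :
    NoCliqueMeets G r M' := fun s hs => (h s hs).mono_right hM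

omit [DecidableRel G.Adj] in
/-- A `k`-clique that meets `M` cannot be extended. -/
lemma NoCliqueMeets.exists_not_adj {k : ℕ} {M C : Finset V} (h : NoCliqueMeets G (k + 1) M)
    (hC : G.IsNClique k C) {w : V} (hw : w ∈ C) (hwM : w ∈ M) (x : V) : ∃ a ∈ C, ¬ G.Adj a x := by
  by_contra! hx
  exact disjoint_left.1 (h _ (hC.insert fun b hb => (hx b hb).symm)) (mem_insert_of_mem hw) hwM

omit [DecidableRel G.Adj] in
/-- The same for the `k`-clique formed by a vertex `v` of `M` and a `(k - 1)`-clique in its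
neighbourhood. -/
lemma NoCliqueMeets.exists_not_adj_of_adj {k : ℕ} (hk : 1 ≤ k) {M S : Finset V}
    (h : NoCliqueMeets G (k + 1) M) (hS : G.IsNClique (k - 1) S) {v : V} (hv : v ∈ M)
    (hvS : ∀ a ∈ S, G.Adj v a) {x : V} (hx : G.Adj v x) : ∃ a ∈ S, ¬ G.Adj a x := by
  have hC := hS.insert hvS
  rw [Nat.sub_add_cancel hk] at hC
  obtain ⟨a, ha, hax⟩ := h.exists_not_adj hC (mem_insert_self v S) hv x
  rcases mem_insert.1 ha with rfl | ha
  · exact absurd hx hax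
  · exact ⟨a, ha, hax⟩

lemma NoCliqueMeets.card_nbrs_le_sum {k : ℕ} (hk : 1 ≤ k) {T M S : Finset V}
    (h : NoCliqueMeets G (k + 1) M) (hS : G.IsNClique (k - 1) S) {v : V} (hv : v ∈ M)
    (hvS : ∀ a ∈ S, G.Adj v a) : #(nbrs G T v) ≤ ∑ a ∈ S, #(conbrs G T a) := by
  refine (card_le_card fun x hx => ?_).trans card_biUnion_le
  obtain ⟨hxT, hx⟩ := mem_nbrs.1 hx
  obtain ⟨a, ha, hax⟩ := h.exists_not_adj_of_adj hk hS hv hvS hx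
  exact mem_biUnion.2 ⟨a, ha, mem_conbrs.2 ⟨hxT, hax⟩⟩

/-! ### The upper bound -/

/-- If all vertices outside `M` have few non-neighbours, then no vertex of `M` has a large degree:
otherwise a greedy choice outside `M` would extend it to a `(k + 1)`-clique. -/
lemma NoCliqueMeets.card_nbrs_le {k : ℕ} (hk : 1 ≤ k) {T M : Finset V}
    (h : NoCliqueMeets G (k + 1) M) (hA : ∀ a ∈ T \ M, #(conbrs G T a) ≤ #M) {v : V}
    (hv : v ∈ M) : #(nbrs G T v) ≤ (k - 1) * #M := by
  by_contra! hlt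
  have hsub : nbrs G T v ⊆ T := filter_subset _ _
  have h1 : #(nbrs G T v \ (T \ M)) + 1 ≤ #M := by
    rw [← card_erase_add_one hv]
    refine Nat.succ_le_succ (card_le_card fun x hx => ?_)
    obtain ⟨hx1, hx2⟩ := mem_sdiff.1 hx
    obtain ⟨hxT, hvx⟩ := mem_nbrs.1 hx1
    refine mem_erase.2 ⟨hvx.ne', ?_⟩
    by_contra hxM
    exact hx2 (mem_sdiff.2 ⟨hxT, hxM⟩)
  obtain ⟨S, hS, hc⟩ := exists_isNClique_of_card_conbrs_le (G := G) (A := T \ M) (D := #M) (k - 1)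
    (nbrs G T v) (fun a ha => (card_le_card (filter_subset_filter _ hsub)).trans (hA a ha))
    (fun _ => by omega)
  have h2 := h.card_nbrs_le_sum (T := T) hk hc hv
    (fun a ha => (mem_nbrs.1 (mem_inter.1 (hS ha)).1).2)
  have h3 : ∑ a ∈ S, #(conbrs G T a) ≤ (k - 1) * #M := by
    rw [← hc.card_eq, ← smul_eq_mul]
    exact sum_le_card_nsmul _ _ _ fun a ha => hA a (mem_inter.1 (hS ha)).2
  omega

/-- The number of edges is at most the extremal number, for `k |M| ≤ |T|`. -/
theorem NoCliqueMeets.adjPairs_le {k : ℕ} (hk : 1 ≤ k) (T : Finset V) :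
    ∀ M ⊆ T, NoCliqueMeets G (k + 1) M → k * #M ≤ #T →
      (adjPairs G T : ℤ) ≤ twoTurm k #T #M := by
  induction T using Finset.strongInduction with
  | H T ih =>
  intro M hMT hM hcard
  rcases M.eq_empty_or_nonempty with rfl | ⟨u, hu⟩
  · have := adjPairs_add_card_le (G := G) T
    zify at this
    simp only [twoTurm, card_empty]
    push_cast
    linarith
  by_cases hA : ∃ x ∈ T \ M, #(nbrs G T x) + 1 + #M ≤ #T
  · obtain ⟨x, hx, hdeg⟩ := hA
    obtain ⟨hxT, hxM⟩ := mem_sdiff.1 hx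
    have hE := adjPairs_erase (G := G) hxT
    have hc := card_erase_add_one hxT
    have hsub : M ⊆ T.erase x := fun y hy =>
      mem_erase.2 ⟨fun h => hxM (h ▸ hy), hMT hy⟩
    rcases hcard.lt_or_eq with hlt | heq
    · have := ih (T.erase x) (erase_ssubset hxT) M hsub hM (by omega)
      rw [hE, ← hc]
      rw [← hc] at hdeg
      unfold twoTurm at this ⊢
      zify at hdeg
      push_cast
      nlinarith
    · -- Here `T` has exactly `k |M|` vertices, so a vertex of `M` has to be given up as well.
      have hMc := card_erase_add_one hu
      have hle : k * #(M.erase u) ≤ #(T.erase x) := by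
        rw [← hMc] at heq
        rw [← hc] at heq
        have : k * (#(M.erase u) + 1) = k * #(M.erase u) + k := by ring
        omega
      have := ih (T.erase x) (erase_ssubset hxT) (M.erase u)
        ((erase_subset _ _).trans hsub) (hM.mono (erase_subset _ _)) hle
      rw [hE, ← hc, ← hMc]
      rw [← hc, ← hMc] at hdeg heq
      unfold twoTurm at this ⊢
      zify at hdeg heq
      push_cast at hdeg heq this ⊢
      nlinarith
  · push Not at hA
    have hv := hM.card_nbrs_le (T := T) hk (fun a ha => by
      have := hA a ha
      have := card_nbrs_add_card_conbrs (G := G) T a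
      omega) hu
    have hE := adjPairs_erase (G := G) (hMT hu)
    have hc := card_erase_add_one (hMT hu)
    have hMc := card_erase_add_one hu
    have hle : k * #(M.erase u) ≤ #(T.erase u) := by
      rw [← hMc, ← hc] at hcard
      have : k * (#(M.erase u) + 1) = k * #(M.erase u) + k := by ring
      omega
    have := ih (T.erase u) (erase_ssubset (hMT hu)) (M.erase u) (erase_subset_erase _ hMT)
      (hM.mono (erase_subset _ _)) hle
    rw [hE, ← hc, ← hMc]
    rw [← hMc] at hv
    unfold twoTurm at this ⊢
    zify [hk] at hv
    push_cast at hv this ⊢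
    nlinarith

lemma twoTurm_div_le {k : ℕ} (hk : 1 ≤ k) {n m : ℕ} (h : n ≤ k * m) :
    twoTurm k n (n / k : ℕ) ≤ twoTurm k n m := by
  obtain ⟨q, s, hs, rfl⟩ : ∃ q s, s < k ∧ n = k * q + s :=
    ⟨n / k, n % k, Nat.mod_lt _ hk, (Nat.div_add_mod n k).symm⟩
  have hq : (k * q + s) / k = q := by
    rw [Nat.mul_add_div hk, Nat.div_eq_of_lt hs, add_zero]
  rw [hq]
  have hqm : q ≤ m := by
    by_contra! hlt
    have := Nat.mul_le_mul_left k (Nat.succ_le_of_lt hlt)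
    rw [Nat.mul_succ] at this
    omega
  obtain ⟨d, rfl⟩ := Nat.exists_eq_add_of_le hqm
  unfold twoTurm
  zify at h hs
  push_cast
  rcases Nat.eq_zero_or_pos d with rfl | hd
  · simp
  · have hd' : (1 : ℤ) ≤ d := by exact_mod_cast hd
    have hk' : (0 : ℤ) ≤ k := by positivity
    have h1 : (0 : ℤ) ≤ d * ((k * d - s) + (k - s)) := by
      have : (s : ℤ) ≤ k * d := by nlinarith
      apply mul_nonneg <;> linarith
    nlinarith

/-- The polynomial bound holds without any assumption on the size of `M`. -/
theorem NoCliqueMeets.adjPairs_le_twoTurm {k : ℕ} (hk : 1 ≤ k) {T M : Finset V} (hMT : M ⊆ T)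
    (hM : NoCliqueMeets G (k + 1) M) : (adjPairs G T : ℤ) ≤ twoTurm k #T #M := by
  rcases le_total (k * #M) #T with h | h
  · exact hM.adjPairs_le hk T M hMT h
  · obtain ⟨M', hM', hc⟩ := exists_subset_card_eq (Nat.div_le_of_le_mul h)
    have := (hM.mono hM').adjPairs_le hk T M' (hM'.trans hMT) (hc ▸ Nat.mul_div_le _ _)
    rw [hc] at this
    exact this.trans (twoTurm_div_le hk h)

/-! ### The graphs attaining the bound -/

/-- The graph described by a partial `k`-colouring and a set `M` of coloured vertices: two distinct
vertices are non-adjacent exactly if they have the same colour, or if one of them lies in `M` and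
the other one is uncoloured. -/
def blockGraph {k : ℕ} (col : V → Option (Fin k)) (M : Finset V) : SimpleGraph V where
  Adj x y := x ≠ y ∧ (col x = col y → col x = none) ∧ (x ∈ M → col y ≠ none) ∧
    (y ∈ M → col x ≠ none)
  symm := ⟨fun _ _ h => ⟨h.1.symm, fun e => e ▸ h.2.1 e.symm, h.2.2.2, h.2.2.1⟩⟩
  loopless := ⟨fun _ h => h.1 rfl⟩

/-- `col` exhibits the subgraph of `G` induced on `T` as a member of the extremal family, with `M`
as its distinguished set: a class with `|M| + 1` vertices is a class `V_i` together with the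
sporadic vertex `v_i`, a class with `|M|` vertices is just `V_i`, and `Y` is the set of uncoloured
vertices. Any vertex outside `M` of a class with `|M| + 1` vertices can play the part of `v_i`,
so that it need not be singled out. -/
structure IsBlockColoring (G : SimpleGraph V) (k : ℕ) (T M : Finset V) (col : V → Option (Fin k)) :
    Prop where
  ne_none : ∀ x ∈ M, col x ≠ none
  card_fibre : ∀ i, #{x ∈ T | col x = some i} = #M ∨ #{x ∈ T | col x = some i} = #M + 1
  adj_iff : ∀ x ∈ T, ∀ y ∈ T, G.Adj x y ↔ (blockGraph col M).Adj x y

omit [DecidableEq V] [DecidableRel G.Adj] in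
lemma blockGraph_adj {k : ℕ} {col : V → Option (Fin k)} {M : Finset V} {x y : V} :
    (blockGraph col M).Adj x y ↔ x ≠ y ∧ (col x = col y → col x = none) ∧
      (x ∈ M → col y ≠ none) ∧ (y ∈ M → col x ≠ none) := Iff.rfl

/-- In an extremal graph, every vertex `x` has degree at least `(k - 1) |M|`, because
deleting `x` lowers the bound by that much, once one element of `M` is given up. -/
lemma NoCliqueMeets.le_card_nbrs {k : ℕ} (hk : 1 ≤ k) {T M : Finset V} (hMT : M ⊆ T)
    (hM : NoCliqueMeets G (k + 1) M) (hne : M.Nonempty) (hE : adjPairs G T = twoTurm k #T #M)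
    {x : V} (hx : x ∈ T) : (k - 1) * #M ≤ #(nbrs G T x) := by
  obtain ⟨u, hu, hsub⟩ : ∃ u ∈ M, M.erase u ⊆ T.erase x := by
    by_cases hxM : x ∈ M
    · exact ⟨x, hxM, erase_subset_erase _ hMT⟩
    · obtain ⟨u, hu⟩ := hne
      refine ⟨u, hu, fun y hy => ?_⟩
      have hy := mem_of_mem_erase hy
      exact mem_erase.2 ⟨fun h => hxM (h ▸ hy), hMT hy⟩
  have h := (hM.mono (erase_subset u M)).adjPairs_le_twoTurm hk hsub
  rw [adjPairs_erase hx] at hE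
  have hc := card_erase_add_one hx
  have hMc := card_erase_add_one hu
  rw [← hc, ← hMc] at hE
  rw [← hMc]
  unfold twoTurm at h hE
  zify [hk]
  push_cast at hE ⊢
  nlinarith

/-- An extremal graph on more than `k |M|` vertices has a vertex outside `M` of
degree at most `n - 1 - |M|`, since the degrees would otherwise have too large a sum. -/
lemma NoCliqueMeets.exists_card_nbrs_le {k : ℕ} (hk : 1 ≤ k) {T M : Finset V} (hMT : M ⊆ T)
    (hM : NoCliqueMeets G (k + 1) M) (hne : M.Nonempty) (hE : adjPairs G T = twoTurm k #T #M)
    (hcard : k * #M < #T) : ∃ x ∈ T \ M, #(nbrs G T x) + 1 + #M ≤ #T := by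
  by_contra! hA
  have h1 : #(T \ M) * (#T - #M) ≤ ∑ x ∈ T \ M, #(nbrs G T x) := by
    rw [← smul_eq_mul]
    refine card_nsmul_le_sum _ _ _ fun x hx => ?_
    have := hA x hx
    omega
  have h2 : #M * ((k - 1) * #M) ≤ ∑ x ∈ M, #(nbrs G T x) := by
    rw [← smul_eq_mul]
    exact card_nsmul_le_sum _ _ _ fun x hx => hM.le_card_nbrs hk hMT hne hE (hMT hx)
  have h3 : adjPairs G T = ∑ x ∈ T \ M, #(nbrs G T x) + ∑ x ∈ M, #(nbrs G T x) :=
    (sum_sdiff hMT).symm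
  have hle := card_le_card hMT
  rw [card_sdiff_of_subset hMT] at h1
  unfold twoTurm at hE
  zify [hle, hk] at h1 h2 h3 hcard
  nlinarith

/-- A vertex outside `M` with exactly `|M|` non-neighbours can be added to a block colouring: it is
either non-adjacent to exactly the vertices of `M`, or joins a class of size `|M|`. -/
lemma IsBlockColoring.exists_of_erase {k : ℕ} {T M : Finset V}
    (hM : NoCliqueMeets G (k + 1) M) {x : V} (hx : x ∈ T) (hxM : x ∉ M)
    (hMT : M ⊆ T) (hdeg : #(conbrs G T x) = #M + 1) {col : V → Option (Fin k)}
    (hcol : IsBlockColoring G k (T.erase x) M col) :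
    ∃ col' : V → Option (Fin k), IsBlockColoring G k T M col' := by
  have hxc : x ∈ conbrs G T x := mem_conbrs.2 ⟨hx, G.irrefl⟩
  have hMx : ∀ y ∈ M, y ≠ x := fun y hy h => hxM (h ▸ hy)
  set N := (conbrs G T x).erase x with hN
  have hNc : #N = #M := by rw [hN, card_erase_of_mem hxc, hdeg]; rfl
  have hNmem : ∀ y, y ∈ N ↔ y ≠ x ∧ y ∈ T ∧ ¬ G.Adj x y := by simp [hN, mem_conbrs]
  -- It suffices to find a colour for `x`.
  have key : ∀ c : Option (Fin k),
      (∀ i, c = some i → #{y ∈ T.erase x | col y = some i} = #M) →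
      (∀ y ∈ T, y ≠ x → (y ∈ N ↔ ((c = col y ∧ c ≠ none) ∨ (y ∈ M ∧ c = none)))) →
      ∃ col' : V → Option (Fin k), IsBlockColoring G k T M col' := by
    intro c hc hadj
    refine ⟨Function.update col x c, ?_, ?_, ?_⟩
    · intro y hy
      rw [Function.update_of_ne (hMx y hy)]
      exact hcol.ne_none y hy
    · intro i
      have hsplit : ∀ p : V → Prop, ∀ [DecidablePred p], {y ∈ T | p y} =
          if p x then insert x {y ∈ T.erase x | p y} else {y ∈ T.erase x | p y} := by
        intro p _
        rw [← insert_erase hx, filter_insert, erase_insert (notMem_erase _ _)]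
      have hcongr : {y ∈ T.erase x | Function.update col x c y = some i} =
          {y ∈ T.erase x | col y = some i} :=
        filter_congr fun y hy => by rw [Function.update_of_ne (ne_of_mem_erase hy)]
      rw [hsplit, hcongr, Function.update_self]
      split_ifs with h
      · rw [card_insert_of_notMem (by simp), hc i h]
        exact Or.inr rfl
      · exact hcol.card_fibre i
    · have hx' : ∀ y ∈ T, y ≠ x →
          (G.Adj x y ↔ (blockGraph (Function.update col x c) M).Adj x y) := by
        intro y hy hyx
        have h1 := hadj y hy hyx
        rw [hNmem] at h1
        rw [blockGraph_adj, Function.update_self, Function.update_of_ne hyx]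
        have := hyx.symm
        tauto
      intro y hy z hz
      by_cases hyx : y = x
      · subst hyx
        by_cases hzy : z = y
        · subst hzy; simp
        · exact hx' z hz hzy
      · by_cases hzx : z = x
        · subst hzx
          rw [SimpleGraph.adj_comm, hx' y hy hyx, SimpleGraph.adj_comm]
        · rw [hcol.adj_iff y (mem_erase.2 ⟨hyx, hy⟩) z (mem_erase.2 ⟨hzx, hz⟩), blockGraph_adj,
            blockGraph_adj, Function.update_of_ne hyx, Function.update_of_ne hzx]
  by_cases hMN : M ⊆ N
  · have hMN := eq_of_subset_of_card_le hMN hNc.le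
    exact key none (by simp) (by simp [← hMN])
  · obtain ⟨u, hu, huN⟩ := not_subset.1 hMN
    have hxu : G.Adj x u := by
      by_contra h
      exact huN ((hNmem u).2 ⟨hMx u hu, hMT hu, h⟩)
    obtain ⟨i, hi⟩ := Option.ne_none_iff_exists'.1 (hcol.ne_none u hu)
    -- Otherwise `x`, `u` and one neighbour of `x` in every other class form a clique.
    have hj : ∃ j, ∀ y ∈ T.erase x, col y = some j → ¬ G.Adj x y := by
      by_contra! hcon
      have hf : ∀ j, ∃ y ∈ T.erase x, col y = some j ∧ G.Adj x y ∧ (j = i → y = u) := by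
        intro j
        by_cases hji : j = i
        · exact ⟨u, mem_erase.2 ⟨hMx u hu, hMT hu⟩, hji ▸ hi, hxu, fun _ => rfl⟩
        · obtain ⟨y, hy, h1, h2⟩ := hcon j
          exact ⟨y, hy, h1, h2, fun h => absurd h hji⟩
      choose f hfT hfc hfx hfu using hf
      have hinj : Function.Injective f := fun a b hab => by
        have := hfc a
        rw [hab, hfc b] at this
        exact (Option.some.inj this).symm
      have hcl : G.IsNClique k (univ.image f) := by
        refine ⟨?_, by simp [card_image_of_injective _ hinj]⟩
        intro a ha b hb hab
        obtain ⟨a, -, rfl⟩ := mem_image.1 (mem_coe.1 ha)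
        obtain ⟨b, -, rfl⟩ := mem_image.1 (mem_coe.1 hb)
        rw [hcol.adj_iff _ (hfT a) _ (hfT b), blockGraph_adj, hfc, hfc]
        exact ⟨hab, fun h => absurd (congrArg f (Option.some.inj h)) hab, by simp, by simp⟩
      obtain ⟨a, ha, hax⟩ := hM.exists_not_adj hcl (w := u)
        (mem_image.2 ⟨i, mem_univ _, hfu i rfl⟩) hu x
      obtain ⟨a, -, rfl⟩ := mem_image.1 ha
      exact hax (hfx a).symm
    obtain ⟨j, hj⟩ := hj
    have hsub : {y ∈ T.erase x | col y = some j} ⊆ N := fun y hy => by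
      obtain ⟨h1, h2⟩ := mem_filter.1 hy
      exact (hNmem y).2 ⟨ne_of_mem_erase h1, mem_of_mem_erase h1, hj y h1 h2⟩
    have hle := card_le_card hsub
    have hcf : #{y ∈ T.erase x | col y = some j} = #M := by
      rcases hcol.card_fibre j with h | h <;> omega
    have heq := eq_of_subset_of_card_le hsub (by omega)
    refine key (some j) (fun i h => by rw [← Option.some.inj h, hcf]) fun y hy hyx => ?_
    rw [← heq]
    simp [hy, hyx, eq_comm]

/-- On exactly `k |M|` vertices the extremal graph is complete `k`-partite: it is regular, and the
non-neighbourhoods of the vertices of a `k`-clique meeting `M` partition the vertex set. -/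
lemma NoCliqueMeets.exists_isBlockColoring_of_card_eq {k : ℕ} (hk : 1 ≤ k) {T M : Finset V}
    (hMT : M ⊆ T) (hM : NoCliqueMeets G (k + 1) M) (hne : M.Nonempty)
    (hE : adjPairs G T = twoTurm k #T #M) (hcard : k * #M = #T) :
    ∃ col : V → Option (Fin k), IsBlockColoring G k T M col := by
  have hkm : (k - 1) * #M + #M = #T := by
    rw [← hcard]
    conv_rhs => rw [← Nat.sub_add_cancel hk, add_mul, one_mul]
  have hdeg : ∀ x ∈ T, #(nbrs G T x) = (k - 1) * #M := by
    have hle : ∀ x ∈ T, (k - 1) * #M ≤ #(nbrs G T x) :=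
      fun x hx => hM.le_card_nbrs hk hMT hne hE hx
    have hsum : ∑ x ∈ T, (k - 1) * #M = ∑ x ∈ T, #(nbrs G T x) := by
      change _ = adjPairs G T
      rw [sum_const, smul_eq_mul]
      zify [hk]
      rw [hE]
      unfold twoTurm
      zify at hcard
      rw [← hcard]
      ring
    exact fun x hx => ((sum_eq_sum_iff_of_le hle).1 hsum x hx).symm
  have hcodeg : ∀ x ∈ T, #(conbrs G T x) = #M := fun x hx => by
    have := card_nbrs_add_card_conbrs (G := G) T x
    have := hdeg x hx
    omega
  obtain ⟨v, hv⟩ := hne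
  have hpos : 0 < #M := card_pos.2 ⟨v, hv⟩
  obtain ⟨S, hS, hSc⟩ := exists_isNClique_of_card_conbrs_le (G := G) (A := T) (D := #M) (k - 1)
    (nbrs G T v) (fun a ha => (card_le_card (filter_subset_filter _ (filter_subset _ _))).trans
      (hcodeg a ha).le) (fun _ => by
        have hsub : nbrs G T v ⊆ T := filter_subset _ _
        rw [sdiff_eq_empty_iff_subset.2 hsub, card_empty, hdeg v (hMT hv)]
        omega)
  have hSv : ∀ a ∈ S, G.Adj v a := fun a ha => (mem_nbrs.1 (mem_inter.1 (hS ha)).1).2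
  have hC := hSc.insert hSv
  rw [Nat.sub_add_cancel hk] at hC
  set C := insert v S
  have hvC : v ∈ C := mem_insert_self _ _
  have hCT : C ⊆ T := insert_subset (hMT hv) fun a ha => (mem_inter.1 (hS ha)).2
  -- By counting, every vertex has a single non-neighbour in a `k`-clique through `v`.
  have huniq : ∀ C ⊆ T, G.IsNClique k C → v ∈ C → ∀ x ∈ T, ∀ a ∈ C, ∀ b ∈ C,
      ¬ G.Adj a x → ¬ G.Adj b x → a = b := by
    intro C hCT hC hvC x hx a ha b hb hax hbx
    have hle : ∀ y ∈ T, 1 ≤ #{a ∈ C | ¬ G.Adj a y} := fun y _ => by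
      obtain ⟨a, ha, hay⟩ := hM.exists_not_adj hC hvC hv y
      exact card_pos.2 ⟨a, mem_filter.2 ⟨ha, hay⟩⟩
    have hsum : ∑ y ∈ T, 1 = ∑ y ∈ T, #{a ∈ C | ¬ G.Adj a y} := by
      have h1 := sum_card_bipartiteAbove_eq_sum_card_bipartiteBelow (s := C) (t := T)
        (fun a y => ¬ G.Adj a y)
      have h2 : ∑ a ∈ C, #(conbrs G T a) = ∑ a ∈ C, #M :=
        sum_congr rfl fun a ha => hcodeg a (hCT ha)
      rw [sum_const, hC.card_eq, smul_eq_mul, hcard] at h2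
      rw [sum_const, smul_eq_mul, mul_one, ← h2]
      exact h1
    have := ((sum_eq_sum_iff_of_le hle).1 hsum x hx).symm
    exact card_le_one.1 this.le a (mem_filter.2 ⟨ha, hax⟩) b (mem_filter.2 ⟨hb, hbx⟩)
  choose g hgC hg using fun x => hM.exists_not_adj hC hvC hv x
  have hfib : ∀ a ∈ C, {y ∈ T | g y = a} = conbrs G T a := by
    intro a ha
    ext y
    rw [mem_filter, mem_conbrs]
    refine and_congr_right fun hy => ⟨fun h => h ▸ hg y, fun h => ?_⟩
    exact huniq C hCT hC hvC y hy _ (hgC y) a ha (hg y) h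
  have hadj1 : ∀ x ∈ T, ∀ y ∈ T, g x ≠ g y → g x ≠ v → G.Adj x y := by
    intro x hx y hy hxy hxv
    by_contra hnot
    have hxC : ∀ w ∈ C \ {g x}, G.Adj x w := by
      intro w hw
      obtain ⟨hwC, hwx⟩ := mem_sdiff.1 hw
      by_contra h
      exact hwx (mem_singleton.2
        (huniq C hCT hC hvC x hx w hwC _ (hgC x) (fun h' => h h'.symm) (hg x)))
    have hC' := hC.insert_erase hxC (hgC x)
    have hb := huniq _ (insert_subset hx ((erase_subset _ _).trans hCT)) hC'
      (mem_insert_of_mem (mem_erase.2 ⟨hxv.symm, hvC⟩)) y hy x (mem_insert_self _ _) (g y)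
      (mem_insert_of_mem (mem_erase.2 ⟨hxy.symm, hgC y⟩)) hnot (hg y)
    have h := hC.isClique (hgC x) (hgC y) hxy
    rw [← hb] at h
    exact hg x h
  have hadj : ∀ x ∈ T, ∀ y ∈ T, g x ≠ g y → G.Adj x y := by
    intro x hx y hy hxy
    by_cases hxv : g x = v
    · exact (hadj1 y hy x hx hxy.symm fun h => hxy (hxv.trans h.symm)).symm
    · exact hadj1 x hx y hy hxy hxv
  have hadj_iff : ∀ x ∈ T, ∀ y ∈ T, G.Adj x y ↔ g x ≠ g y := by
    intro x hx y hy
    refine ⟨fun h hxy => ?_, hadj x hx y hy⟩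
    have hsub : conbrs G T x ⊆ {z ∈ T | g z = g x} := fun z hz => by
      obtain ⟨hzT, hxz⟩ := mem_conbrs.1 hz
      refine mem_filter.2 ⟨hzT, ?_⟩
      by_contra hne
      exact hxz (hadj x hx z hzT (Ne.symm hne))
    have heq := eq_of_subset_of_card_le hsub (by
      rw [hfib _ (hgC x), hcodeg x hx, hcodeg _ (hCT (hgC x))])
    have : y ∈ conbrs G T x := heq ▸ mem_filter.2 ⟨hy, hxy.symm⟩
    exact (mem_conbrs.1 this).2 h
  let e : C ≃ Fin k := C.equivFinOfCardEq hC.card_eq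
  refine ⟨fun x => some (e ⟨g x, hgC x⟩), fun x _ => by simp, fun i => Or.inl ?_, ?_⟩
  · have : {x ∈ T | some (e ⟨g x, hgC x⟩) = some i} = {y ∈ T | g y = e.symm i} := by
      refine filter_congr fun x _ => ?_
      rw [Option.some_inj, ← Equiv.eq_symm_apply, Subtype.ext_iff]
    rw [this, hfib _ (e.symm i).2, hcodeg _ (hCT (e.symm i).2)]
  · intro x hx y hy
    rw [hadj_iff x hx y hy, blockGraph_adj]
    simp only [Option.some_inj, e.apply_eq_iff_eq, Subtype.mk.injEq, reduceCtorEq, imp_false,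
      ne_eq, not_false_eq_true, implies_true, and_true]
    exact ⟨fun h => ⟨fun hxy => h (congrArg g hxy), h⟩, fun h => h.2⟩

/-- The graphs attaining the bound are those with a block colouring. -/
theorem NoCliqueMeets.exists_isBlockColoring {k : ℕ} (hk : 1 ≤ k) (T : Finset V) :
    ∀ M ⊆ T, NoCliqueMeets G (k + 1) M → k * #M ≤ #T → adjPairs G T = twoTurm k #T #M →
      ∃ col : V → Option (Fin k), IsBlockColoring G k T M col := by
  induction T using Finset.strongInduction with
  | H T ih =>
  intro M hMT hM hcard hE
  rcases M.eq_empty_or_nonempty with rfl | hne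
  · have h : ∀ x ∈ T, 1 ≤ #(conbrs G T x) :=
      fun x hx => card_pos.2 ⟨x, mem_conbrs.2 ⟨hx, G.irrefl⟩⟩
    have hsum : ∑ x ∈ T, 1 = ∑ x ∈ T, #(conbrs G T x) := by
      have h1 : adjPairs G T + ∑ x ∈ T, #(conbrs G T x) = #T * #T := by
        rw [adjPairs, ← sum_add_distrib, sum_congr rfl fun x _ => card_nbrs_add_card_conbrs T x,
          sum_const, smul_eq_mul]
      unfold twoTurm at hE
      rw [sum_const, smul_eq_mul, mul_one]
      zify at h1 ⊢
      simp only [card_empty] at hE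
      push_cast at hE
      linarith
    refine ⟨fun _ => none, by simp, by simp, fun x hx y hy => ?_⟩
    simp only [blockGraph_adj, notMem_empty, implies_true, and_true, false_imp_iff]
    refine ⟨fun h => h.ne, fun hxy => ?_⟩
    by_contra hn
    have := ((sum_eq_sum_iff_of_le h).1 hsum x hx).symm
    exact hxy (card_le_one.1 this.le x (mem_conbrs.2 ⟨hx, G.irrefl⟩) y (mem_conbrs.2 ⟨hy, hn⟩))
  rcases hcard.eq_or_lt with heq | hlt
  · exact hM.exists_isBlockColoring_of_card_eq hk hMT hne hE heq
  obtain ⟨x, hx, hdeg⟩ := hM.exists_card_nbrs_le hk hMT hne hE hlt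
  obtain ⟨hxT, hxM⟩ := mem_sdiff.1 hx
  have hsub : M ⊆ T.erase x := fun y hy => mem_erase.2 ⟨fun h => hxM (h ▸ hy), hMT hy⟩
  have hle := hM.adjPairs_le_twoTurm hk hsub
  have hEx := hE
  have hc := card_erase_add_one hxT
  have hco := card_nbrs_add_card_conbrs (G := G) T x
  rw [adjPairs_erase hxT, ← hc] at hEx
  rw [← hc] at hdeg hco
  have h1 : #(nbrs G T x) + #M = #(T.erase x) := by
    unfold twoTurm at hle hEx
    push_cast at hEx
    have : (#(T.erase x) : ℤ) ≤ #(nbrs G T x) + #M := by nlinarith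
    omega
  have h2 : (adjPairs G (T.erase x) : ℤ) = twoTurm k #(T.erase x) #M := by
    unfold twoTurm at hEx ⊢
    zify at h1
    push_cast at hEx
    nlinarith
  obtain ⟨col, hcol⟩ := ih _ (erase_ssubset hxT) M hsub hM (by omega) h2
  exact hcol.exists_of_erase hM hxT hxM hMT (by omega)

end

section

/-! ### The extremal family -/

/-- The `j`-th old vertex of the colour class `V_i`. -/
def oldVertex {k m : ℕ} (i : Fin k) (j : Fin m) : Fin (k * m) :=
  ⟨i + k * j, by
    have h : k * (j + 1) ≤ k * m := Nat.mul_le_mul_left k j.2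
    have := i.2
    rw [mul_add, mul_one] at h
    omega⟩

lemma oldVertex_mod {k m : ℕ} (i : Fin k) (j : Fin m) : (oldVertex i j : ℕ) % k = i := by
  simp [oldVertex, Nat.mod_eq_of_lt i.2]

lemma oldVertex_inj {k m : ℕ} {i i' : Fin k} {j j' : Fin m} :
    oldVertex i j = oldVertex i' j' ↔ i = i' ∧ j = j' := by
  refine ⟨fun h => ?_, by rintro ⟨rfl, rfl⟩; rfl⟩
  have hi : i = i' := by
    have h1 := oldVertex_mod i j
    rw [h, oldVertex_mod] at h1
    exact (Fin.ext h1).symm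
  subst hi
  refine ⟨rfl, ?_⟩
  have h2 := congrArg Fin.val h
  simp only [oldVertex, add_right_inj] at h2
  exact Fin.ext (Nat.eq_of_mul_eq_mul_left (lt_of_le_of_lt (Nat.zero_le _) i.2) h2)

lemma exists_oldVertex_eq {k m : ℕ} (u : Fin (k * m)) :
    ∃ (i : Fin k) (j : Fin m), oldVertex i j = u := by
  have hk : 0 < k := Nat.pos_of_ne_zero fun h => by
    have := u.2
    simp [h] at this
  exact ⟨⟨u % k, Nat.mod_lt _ hk⟩, ⟨u / k, Nat.div_lt_of_lt_mul u.2⟩,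
    Fin.ext (Nat.mod_add_div _ _)⟩

variable {V : Type*} [DecidableEq V] {G : SimpleGraph V}

/-- On more than `k |M|` vertices, a graph with a block colouring belongs to the extremal family:
from every class with `|M| + 1` vertices, some vertex outside `M` is made sporadic. -/
theorem IsBlockColoring.isTurm [Fintype V] {k m : ℕ} {M : Finset V} (hm : #M = m)
    {col : V → Option (Fin k)} (h : IsBlockColoring G k univ M col)
    (hcard : k * m < Fintype.card V) : IsTurm k m G := by
  classical
  rw [IsTurm, if_neg hcard.not_ge]
  set n := Fintype.card V with hn
  have hP : ∀ i : Fin k, ∃ P : Finset V, {x ∈ M | col x = some i} ⊆ P ∧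
      P ⊆ univ.filter (fun x => col x = some i) ∧ #P = m := by
    intro i
    refine exists_subsuperset_card_eq (fun x hx => ?_) (hm ▸ card_filter_le _ _) ?_
    · simpa using (mem_filter.1 hx).2
    · rcases h.card_fibre i with h | h <;> omega
  choose P hMP hPcol hPc using hP
  let ψ : ∀ i, P i ≃ Fin m := fun i => (P i).equivFinOfCardEq (hPc i)
  have hone : ∀ i x y, col x = some i → col y = some i → x ∉ P i → y ∉ P i → x = y := by
    intro i x y hx hy hxP hyP
    have hle : #(univ.filter (fun x => col x = some i) \ P i) ≤ 1 := by
      rw [card_sdiff_of_subset (hPcol i), hPc]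
      rcases h.card_fibre i with h | h <;> omega
    exact card_le_one.1 hle x (by simp [hx, hxP]) y (by simp [hy, hyP])
  have hcolP : ∀ i, ∀ x ∈ P i, col x = some i := fun i x hx => by simpa using hPcol i hx
  have hsumP : k * m ≤ #({x | col x ≠ none} : Finset V) := by
    have hdisj : Set.PairwiseDisjoint (↑(univ : Finset (Fin k))) P := by
      intro i _ j _ hij
      refine disjoint_left.2 fun x hx hy => hij ?_
      have := hcolP i x hx
      rw [hcolP j x hy] at this
      exact (Option.some.inj this).symm
    have hc := card_biUnion hdisj
    simp only [hPc, sum_const, card_univ, Fintype.card_fin, smul_eq_mul] at hc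
    rw [← hc]
    refine card_le_card fun x hx => ?_
    obtain ⟨i, -, hx⟩ := mem_biUnion.1 hx
    simp [hcolP i x hx]
  obtain ⟨ρ⟩ : Nonempty ({x // col x = none} ↪ Fin (n - k * m)) := by
    refine Function.Embedding.nonempty_of_card_le ?_
    rw [Fintype.card_fin, Fintype.card_subtype]
    have := card_filter_add_card_filter_not (s := (univ : Finset V)) (fun x => col x = none)
    rw [card_univ] at this
    have h' : #({x | ¬ col x = none} : Finset V) = #({x | col x ≠ none} : Finset V) := rfl
    omega
  have hφ : ∀ x, ∃ z : Fin (k * m) ⊕ (Fin k ⊕ Fin (n - k * m)),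
      (∃ i, ∃ hx : x ∈ P i, z = .inl (oldVertex i (ψ i ⟨x, hx⟩))) ∨
      (∃ i, col x = some i ∧ x ∉ P i ∧ z = .inr (.inl i)) ∨
      (∃ hx : col x = none, z = .inr (.inr (ρ ⟨x, hx⟩))) := by
    intro x
    by_cases hc : col x = none
    · exact ⟨_, Or.inr (Or.inr ⟨hc, rfl⟩)⟩
    · obtain ⟨i, hi⟩ := Option.ne_none_iff_exists'.1 hc
      by_cases hx : x ∈ P i
      · exact ⟨_, Or.inl ⟨i, hx, rfl⟩⟩
      · exact ⟨_, Or.inr (Or.inl ⟨i, hi, hx, rfl⟩)⟩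
  choose φ hφ using hφ
  have hinj : Function.Injective φ := by
    intro x y hxy
    rcases hφ x with ⟨i, hx, hz⟩ | ⟨i, hx, hxP, hz⟩ | ⟨hx, hz⟩ <;>
    rcases hφ y with ⟨j, hy, hz'⟩ | ⟨j, hy, hyP, hz'⟩ | ⟨hy, hz'⟩ <;>
    rw [hxy, hz'] at hz <;> simp only [Sum.inl.injEq, Sum.inr.injEq, reduceCtorEq] at hz
    · obtain ⟨rfl, hz⟩ := oldVertex_inj.1 hz
      exact (congrArg Subtype.val ((ψ j).injective hz)).symm
    · subst hz
      exact hone j x y hx hy hxP hyP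
    · exact (congrArg Subtype.val (ρ.injective hz)).symm
  have hold : ∀ u, ∃ x, φ x = .inl u := by
    intro u
    obtain ⟨i, j, rfl⟩ := exists_oldVertex_eq u
    have hx := ((ψ i).symm j).2
    refine ⟨(ψ i).symm j, ?_⟩
    rcases hφ ((ψ i).symm j) with ⟨i', hx', hz⟩ | ⟨i', hx', hxP, hz⟩ | ⟨hx', hz⟩
    · have hi := hcolP _ _ hx'
      rw [hcolP _ _ hx] at hi
      obtain rfl := Option.some.inj hi
      simpa using hz
    · rw [hcolP _ _ hx] at hx'
      obtain rfl := Option.some.inj hx'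
      exact absurd hx hxP
    · rw [hcolP _ _ hx] at hx'
      simp at hx'
  have hMold : ∀ x ∈ M, ∃ u, φ x = .inl u := by
    intro x hx
    obtain ⟨i, hi⟩ := Option.ne_none_iff_exists'.1 (h.ne_none x hx)
    rcases hφ x with ⟨i', hx', hz⟩ | ⟨i', hx', hxP, hz⟩ | ⟨hx', hz⟩
    · exact ⟨_, hz⟩
    · exact absurd (hMP i' (mem_filter.2 ⟨hx, hx'⟩)) hxP
    · exact absurd hx' (h.ne_none x hx)
  let M' : Finset (Fin (k * m)) := {u | ∃ x ∈ M, φ x = .inl u}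
  have hM' : ∀ {x u}, φ x = .inl u → (u ∈ M' ↔ x ∈ M) := by
    intro x u hxu
    simp only [M', mem_filter, mem_univ, true_and]
    refine ⟨?_, fun hx => ⟨x, hx, hxu⟩⟩
    rintro ⟨y, hy, hyu⟩
    exact hinj (hyu.trans hxu.symm) ▸ hy
  have hM'c : #M' = m := by
    have : M'.image Sum.inl = M.image φ := by
      ext z
      simp only [mem_image]
      constructor
      · rintro ⟨u, hu, rfl⟩
        obtain ⟨x, hx, hxu⟩ := (mem_filter.1 hu).2
        exact ⟨x, hx, hxu⟩
      · rintro ⟨x, hx, rfl⟩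
        obtain ⟨u, hu⟩ := hMold x hx
        exact ⟨u, (hM' hu).2 hx, hu.symm⟩
    have hc := congrArg card this
    rwa [card_image_of_injective _ Sum.inl_injective, card_image_of_injective _ hinj, hm] at hc
  let D : Finset (Fin k ⊕ Fin (n - k * m)) := {d | ∀ x, φ x ≠ .inr d}
  have hDc : #D = k := by
    have h1 : (univ.image φ)ᶜ = D.image Sum.inr := by
      ext z
      simp only [mem_compl, mem_image, mem_univ, true_and, not_exists, D, mem_filter]
      constructor
      · intro hz
        rcases z with u | d
        · exact absurd (hold u).choose_spec (hz _)
        · exact ⟨d, hz, rfl⟩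
      · rintro ⟨d, hd, rfl⟩
        exact hd
    have h2 := congrArg card h1
    rw [card_compl, card_image_of_injective _ hinj, card_image_of_injective _ Sum.inr_injective,
      card_univ, Fintype.card_sum, Fintype.card_sum, Fintype.card_fin, Fintype.card_fin,
      Fintype.card_fin] at h2
    omega
  have hMspor : ∀ {i x}, col x = some i → x ∉ P i → x ∉ M := fun hx hxP hxM =>
    hxP (hMP _ (mem_filter.2 ⟨hxM, hx⟩))
  have hMnone : ∀ {x}, col x = none → x ∉ M := fun hx hxM => h.ne_none _ hxM hx
  have hadj : ∀ x y, (bigGraph k n m M').Adj (φ x) (φ y) ↔ G.Adj x y := by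
    intro x y
    rw [h.adj_iff x (mem_univ _) y (mem_univ _), blockGraph_adj]
    change bigAdj k n m M' _ _ ↔ _
    have hsame : ∀ {i j}, col x = some i → col y = some j →
        ((x ≠ y ∧ (col x = col y → col x = none) ∧ (x ∈ M → col y ≠ none) ∧
          (y ∈ M → col x ≠ none)) ↔ i ≠ j) := by
      intro i j hx hy
      rw [hx, hy]
      simp only [Option.some_inj, reduceCtorEq, imp_false, ne_eq, not_false_eq_true,
        implies_true, and_true, and_iff_right_iff_imp]
      rintro hij rfl
      rw [hx] at hy
      exact hij (Option.some.inj hy)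
    rcases hφ x with ⟨i, hx, hz⟩ | ⟨i, hx, hxP, hz⟩ | ⟨hx, hz⟩ <;>
    rcases hφ y with ⟨j, hy, hz'⟩ | ⟨j, hy, hyP, hz'⟩ | ⟨hy, hz'⟩
    · rw [hsame (hcolP _ _ hx) (hcolP _ _ hy), hz, hz', bigAdj, SimpleGraph.turanGraph_adj,
        oldVertex_mod, oldVertex_mod, Fin.val_ne_iff]
    · rw [hsame (hcolP _ _ hx) hy, hz, hz', bigAdj, oldVertex_mod, Fin.val_ne_iff]
    · have hxM := hM' hz
      rw [hz, hz', bigAdj, hxM, hcolP _ _ hx, hy]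
      have hne : x ≠ y := fun e => by
        have := hcolP _ _ hx
        rw [e, hy] at this
        simp at this
      simp [hne, hMnone hy]
    · rw [hsame hx (hcolP _ _ hy), hz, hz', bigAdj, oldVertex_mod, Fin.val_ne_iff, ne_comm]
    · rw [hsame hx hy, hz, hz', bigAdj]
      simp
    · have hne : x ≠ y := fun e => by
        rw [e, hy] at hx
        simp at hx
      rw [hz, hz', bigAdj, hx, hy]
      simp [hne, hMnone hy, hMspor hx hxP]
    · have hyM := hM' hz'
      rw [hz, hz', bigAdj, hyM, hcolP _ _ hy, hx]
      have hne : x ≠ y := fun e => by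
        have := hcolP _ _ hy
        rw [← e, hx] at this
        simp at this
      simp [hne, hMnone hx]
    · have hne : x ≠ y := fun e => by
        rw [← e, hx] at hy
        simp at hy
      rw [hz, hz', bigAdj, hx, hy]
      simp [hne, hMnone hx, hMspor hy hyP]
    · rw [hz, hz', bigAdj, hx, hy]
      simp [hMnone hx, hMnone hy]
  refine ⟨M', hM'c, D, hDc, ?_⟩
  have hmem : ∀ x, φ x ∈ {z | ∀ d ∈ D, z ≠ Sum.inr d} := fun x d hd => (mem_filter.1 hd).2 x
  refine ⟨⟨Equiv.ofBijective (fun x => ⟨φ x, hmem x⟩) ⟨fun x y hxy => ?_, ?_⟩, hadj _ _⟩⟩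
  · exact hinj (congrArg Subtype.val hxy)
  · rintro ⟨u | d, hz⟩
    · obtain ⟨x, hx⟩ := hold u
      exact ⟨x, Subtype.ext hx⟩
    · have hd : d ∉ D := fun hd => hz d hd rfl
      simp only [D, mem_filter, mem_univ, true_and, not_forall, not_not] at hd
      obtain ⟨x, hx⟩ := hd
      exact ⟨x, Subtype.ext hx⟩

lemma two_mul_choose_two_add (n : ℕ) : 2 * n.choose 2 + n = n * n := by
  rcases n with _ | n
  · rfl
  · have h := (Nat.even_mul_succ_self n).two_dvd
    rw [Nat.choose_two_right, Nat.add_sub_cancel, Nat.mul_div_cancel' (by rwa [mul_comm])]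
    ring

/-- The polynomial bound at `m = ⌊n / k⌋` is the Turán number. -/
lemma two_mul_tur {k : ℕ} (hk : 1 ≤ k) (n : ℕ) :
    2 * (tur k n : ℤ) = twoTurm k n (n / k : ℕ) := by
  induction n using Nat.strong_induction_on with
  | _ n ih =>
  rcases lt_or_ge n k with h | h
  · have htop : SimpleGraph.turanGraph n k = ⊤ := SimpleGraph.turanGraph_eq_top.2 (Or.inr h.le)
    have hc : tur k n = n.choose 2 := by
      have := SimpleGraph.card_edgeFinset_top_eq_card_choose_two (V := Fin n)
      rw [Fintype.card_fin] at this
      rw [tur, ← this]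
      congr 1
      ext e
      rw [SimpleGraph.mem_edgeFinset, SimpleGraph.mem_edgeFinset, htop]
    rw [hc, Nat.div_eq_of_lt h, twoTurm]
    have h3 := two_mul_choose_two_add n
    zify at h3
    push_cast
    linarith
  · obtain ⟨d, rfl⟩ := Nat.exists_eq_add_of_le' h
    have hrec := SimpleGraph.card_edgeFinset_turanGraph_add (n := d) (r := k)
    have hkc := two_mul_choose_two_add k
    have := ih d (by omega)
    change tur k (d + k) = tur k d + _ + _ at hrec
    rw [Nat.add_div_right _ hk, hrec]
    unfold twoTurm at this ⊢
    have hk' : ((k - 1 : ℕ) : ℤ) = k - 1 := by push_cast [hk]; ring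
    have hmod : (k : ℤ) * (d / k : ℕ) ≤ d := by exact_mod_cast Nat.mul_div_le d k
    zify at hkc
    push_cast at this ⊢
    rw [hk']
    nlinarith

/-! ### Block graphs belong to the family; the exact theorem -/

/-- For either case of the definition of `turm`. -/
lemma two_mul_turm {k : ℕ} (hk : 1 ≤ k) (n m : ℕ) :
    2 * turm k n m = twoTurm k n (min m (n / k) : ℕ) := by
  unfold turm
  split_ifs with h
  · rw [min_eq_right (Nat.div_le_of_le_mul h), two_mul_tur hk]
  · rw [min_eq_left ((Nat.le_div_iff_mul_le hk).2 (by rw [mul_comm]; omega))]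
    have h1 := two_mul_choose_two_add n
    have h2 := two_mul_choose_two_add (m + 1)
    unfold twoTurm
    zify at h1 h2
    have h3 : 2 * ((m + 1).choose 2 : ℤ) = m * (m + 1) := by linarith
    linear_combination h1 + k * h3

lemma card_le_of_isClique_blockGraph {k : ℕ} {col : V → Option (Fin k)} {M Q : Finset V}
    (hQ : (blockGraph col M).IsClique Q) (hcol : ∀ x ∈ Q, col x ≠ none) : #Q ≤ k := by
  have h : Set.InjOn col Q := fun x hx y hy hxy => by
    by_contra hne
    exact hcol x hx ((hQ hx hy hne).2.1 hxy)
  rw [← card_image_of_injOn h]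
  have hsub : Q.image col ⊆ univ.image some := fun c hc => by
    obtain ⟨x, hx, rfl⟩ := mem_image.1 hc
    obtain ⟨i, hi⟩ := Option.ne_none_iff_exists'.1 (hcol x hx)
    simp [hi]
  refine (card_le_card hsub).trans (card_image_le.trans ?_)
  simp

lemma noCliqueMeets_blockGraph {k : ℕ} {col : V → Option (Fin k)} {M : Finset V}
    (hcol : ∀ x ∈ M, col x ≠ none) : NoCliqueMeets (blockGraph col M) (k + 1) M := by
  intro Q hQ
  refine disjoint_left.2 fun u hu huM => ?_
  have := card_le_of_isClique_blockGraph hQ.isClique fun x hx => ?_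
  · have := hQ.card_eq
    omega
  · by_cases hux : u = x
    · exact hux ▸ hcol u huM
    · exact (hQ.isClique hu hx hux).2.2.1 huM

omit [DecidableEq V] in
/-- Turán's theorem, phrased for the first case of the definition of the extremal family. -/
lemma isTurm_of_cliqueFree [Fintype V] [DecidableRel G.Adj] {k m : ℕ} (hk : 1 ≤ k)
    (hcard : Fintype.card V ≤ k * m)
    (hG : G.CliqueFree (k + 1))
    (hE : twoTurm k (Fintype.card V) (Fintype.card V / k : ℕ) ≤ adjPairs G univ) :
    IsTurm k m G := by
  rw [IsTurm, if_pos hcard, ← SimpleGraph.isTuranMaximal_iff_nonempty_iso_turanGraph hk]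
  refine ⟨hG, fun G' _ hG' => ?_⟩
  have h1 := hG'.card_edgeFinset_le
  dsimp only at h1
  rw [← SimpleGraph.card_edgeFinset_turanGraph] at h1
  rw [← two_mul_tur hk, adjPairs_univ, ← SimpleGraph.coe_edgeFinset, Set.ncard_coe_finset] at hE
  change _ ≤ tur k (Fintype.card V) at h1
  push_cast at hE
  have h2 : tur k (Fintype.card V) ≤ #G.edgeFinset := by zify; linarith
  exact h1.trans h2

/-- A complete `k`-partite graph with class sizes `⌊n / k⌋` and `⌊n / k⌋ + 1` is the Turán graph. -/
lemma isTurm_blockGraph_of_card_le [Fintype V] {k m : ℕ} (hk : 1 ≤ k)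
    (hcard : Fintype.card V ≤ k * m) {col : V → Option (Fin k)} (M : Finset V)
    (hcol : ∀ x, col x ≠ none)
    (hfib : ∀ i, #{x | col x = some i} = Fintype.card V / k ∨
      #{x | col x = some i} = Fintype.card V / k + 1) :
    IsTurm k m (blockGraph col M) := by
  classical
  set n := Fintype.card V with hn
  set q := n / k
  refine isTurm_of_cliqueFree hk hcard (fun Q hQ => ?_) (le_of_eq ?_)
  · have := card_le_of_isClique_blockGraph hQ.isClique fun x _ => hcol x
    have := hQ.card_eq
    omega
  have hco : ∀ x, conbrs (blockGraph col M) univ x = ({y | col y = col x} : Finset V) := by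
    intro x
    ext y
    simp only [mem_conbrs, blockGraph_adj, mem_univ, true_and, mem_filter, hcol, ne_eq,
      not_false_eq_true, implies_true, and_true, imp_false, not_and, not_not]
    exact ⟨fun h => by
      by_cases hxy : x = y
      · rw [hxy]
      · exact (h hxy).symm, fun h _ => h.symm⟩
  have hpart : ∀ f : V → ℤ, ∑ x, f x = ∑ i : Fin k, ∑ x ∈ univ.filter (col · = some i), f x := by
    intro f
    rw [← sum_fiberwise (s := univ) (g := col) (f := f), Fintype.sum_option,
      filter_false_of_mem fun x _ => hcol x, sum_empty, zero_add]
  have h1 : (adjPairs (blockGraph col M) univ : ℤ) + ∑ x, (#(conbrs (blockGraph col M) univ x) : ℤ)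
      = n * n := by
    rw [adjPairs, Nat.cast_sum, ← sum_add_distrib,
      sum_congr rfl fun x _ => by rw [← Nat.cast_add, card_nbrs_add_card_conbrs], sum_const,
      card_univ, nsmul_eq_mul]
  -- Each class size `f` satisfies `f ^ 2 = (2 q + 1) f - q (q + 1)`.
  have h2 : ∑ x, (#(conbrs (blockGraph col M) univ x) : ℤ) =
      ∑ i : Fin k, ((2 * q + 1) * ∑ x ∈ univ.filter (col · = some i), 1 - q * (q + 1) : ℤ) := by
    rw [hpart]
    refine sum_congr rfl fun i _ => ?_
    have : ∀ x ∈ univ.filter (col · = some i), (#(conbrs (blockGraph col M) univ x) : ℤ) =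
        #({y | col y = some i} : Finset V) := fun x hx => by
      rw [hco, (mem_filter.1 hx).2]
    rw [sum_congr rfl this, sum_const, sum_const, nsmul_eq_mul, nsmul_eq_mul, mul_one]
    rcases hfib i with h | h <;> rw [h] <;> push_cast <;> ring
  have h3 := hpart fun _ => 1
  rw [sum_sub_distrib, ← mul_sum, ← h3, sum_const, sum_const, card_univ, card_univ,
    Fintype.card_fin, ← hn] at h2
  simp only [nsmul_eq_mul, mul_one] at h2
  unfold twoTurm
  linarith

/-- Let `G` be extremal for `M' ⊆ M`. If `M' ≠ M`, then `G` is `K_{k+1}`-free, because a vertex of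
`M \ M'` would be adjacent to all but at most one vertex of a `(k + 1)`-clique. If `n = k |M'|`,
then `G` is `K_{k+1}`-free because no vertex is uncoloured. -/
lemma IsBlockColoring.cliqueFree [Fintype V] {k : ℕ} {M M' : Finset V}
    (hM : NoCliqueMeets G (k + 1) M) (hMM : M' ⊆ M) {col : V → Option (Fin k)}
    (h : IsBlockColoring G k univ M' col) (hcase : M' ≠ M ∨ k * #M' = Fintype.card V) :
    G.CliqueFree (k + 1) := by
  have hG : G = blockGraph col M' := by
    ext x y
    exact h.adj_iff x (mem_univ _) y (mem_univ _)
  intro Q hQ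
  rcases hcase with hne | heq
  · obtain ⟨u, hu, hu'⟩ := exists_of_ssubset (hMM.ssubset_of_ne hne)
    have hQM := disjoint_left.1 (hM Q hQ)
    have hnon : ∀ q ∈ Q, ¬ G.Adj u q → col u = col q ∧ col u ≠ none := by
      intro q hq hadj
      have hne : u ≠ q := fun e => hQM hq (e ▸ hu)
      have hq' : q ∉ M' := fun hq' => hQM hq (hMM hq')
      rw [hG, blockGraph_adj] at hadj
      tauto
    obtain ⟨b, hb, hall⟩ : ∃ b ∈ Q, ∀ q ∈ Q, q ≠ b → G.Adj u q := by
      by_contra! hcon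
      obtain ⟨q₀, hq₀⟩ : Q.Nonempty := by rw [← card_pos, hQ.card_eq]; omega
      obtain ⟨q₁, hq₁, -, h₁⟩ := hcon q₀ hq₀
      obtain ⟨q₂, hq₂, h₂₁, h₂⟩ := hcon q₁ hq₁
      obtain ⟨e₁, n₁⟩ := hnon q₁ hq₁ h₁
      obtain ⟨e₂, -⟩ := hnon q₂ hq₂ h₂
      have := hQ.isClique hq₁ hq₂ h₂₁.symm
      rw [hG, blockGraph_adj, ← e₁, ← e₂] at this
      exact n₁ (this.2.1 rfl)
    have := hQ.insert_erase (a := u) (b := b) (fun w hw => by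
      obtain ⟨hw, hwb⟩ := mem_sdiff.1 hw
      exact hall w hw fun e => hwb (mem_singleton.2 e)) hb
    exact disjoint_left.1 (hM _ this) (mem_insert_self _ _) hu
  · have hnone : ∀ x, col x ≠ none := by
      have h1 : ∑ i : Fin k, #{x | col x = some i} + #{x | col x = none} = Fintype.card V := by
        have := card_eq_sum_card_fiberwise (f := col) (s := univ) (t := univ) (by simp)
        rw [Fintype.sum_option, card_univ] at this
        rw [this, add_comm]
      have h2 : k * #M' ≤ ∑ i : Fin k, #{x | col x = some i} := by
        have := card_nsmul_le_sum (univ : Finset (Fin k)) (fun i => #{x | col x = some i}) #M'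
          fun i _ => by rcases h.card_fibre i with h | h <;> omega
        simpa using this
      have h3 : #{x | col x = none} = 0 := by omega
      intro x hx
      have : x ∈ ({x | col x = none} : Finset V) := by simpa using hx
      rw [card_eq_zero.1 h3] at this
      simp at this
    rw [hG] at hQ
    have := card_le_of_isClique_blockGraph hQ.isClique fun x _ => hnone x
    have := hQ.card_eq
    omega

/-- The graphs with at least the extremal number of edges belong to the extremal family. -/
theorem NoCliqueMeets.isTurm [Fintype V] [DecidableRel G.Adj] {k : ℕ} (hk : 1 ≤ k) {M : Finset V}
    (hM : NoCliqueMeets G (k + 1) M)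
    (hE : twoTurm k (Fintype.card V) (min #M (Fintype.card V / k) : ℕ) ≤ adjPairs G univ) :
    IsTurm k #M G := by
  set n := Fintype.card V with hn
  obtain ⟨M', hMM, hc⟩ := exists_subset_card_eq (min_le_left #M (n / k))
  have hle : k * #M' ≤ n := by
    rw [hc]
    exact (Nat.mul_le_mul_left k (min_le_right _ _)).trans (Nat.mul_div_le n k)
  have hM' := hM.mono hMM
  have hub := hM'.adjPairs_le hk univ M' (subset_univ _) (by rwa [card_univ])
  rw [card_univ, ← hn] at hub
  rw [← hc] at hE
  obtain ⟨col, hcol⟩ := hM'.exists_isBlockColoring hk univ M' (subset_univ _)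
    (by rwa [card_univ]) (by rw [card_univ]; exact le_antisymm hub hE)
  rcases lt_or_ge (k * #M) n with hlt | hge
  · have hMc : #M' = #M := by
      rw [hc, min_eq_left ((Nat.le_div_iff_mul_le hk).2 (by rw [mul_comm]; exact hlt.le))]
    exact (hcol.isTurm hMc hlt)
  · have hMc : #M' = n / k := by rw [hc, min_eq_right (Nat.div_le_of_le_mul hge)]
    rw [hMc] at hE
    refine isTurm_of_cliqueFree hk hge (hcol.cliqueFree hM hMM ?_) hE
    by_contra! hcon
    rw [hcon.1] at hle
    exact hcon.2 (hcon.1 ▸ le_antisymm hle hge)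

end

section

variable {V : Type*} [DecidableEq V] {G : SimpleGraph V} [DecidableRel G.Adj]

/-! ### Approximate structure under minimum degree conditions -/

/-- Double counting: if the vertices of `C` have at most `D` non-neighbours each, and every vertex
of `U` has one in `C`, then few vertices have a second one or lie outside `U`. -/
lemma card_exceptional_add_card_le [Fintype V] {C U : Finset V} {D : ℕ}
    (hD : ∀ a ∈ C, #(conbrs G univ a) ≤ D) (hU : ∀ x ∈ U, ∃ a ∈ C, ¬ G.Adj a x) :
    #{x | (x ∈ U → 2 ≤ #{a ∈ C | ¬ G.Adj a x}) ∧ (x ∉ U → ∃ a ∈ C, ¬ G.Adj a x)} + #U ≤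
      #C * D := by
  set E : Finset V :=
    {x | (x ∈ U → 2 ≤ #{a ∈ C | ¬ G.Adj a x}) ∧ (x ∉ U → ∃ a ∈ C, ¬ G.Adj a x)} with hE
  have h1 : ∑ x, #{a ∈ C | ¬ G.Adj a x} ≤ #C * D := by
    rw [← smul_eq_mul]
    refine le_trans (le_of_eq ?_) (sum_le_card_nsmul _ _ _ hD)
    exact (sum_card_bipartiteAbove_eq_sum_card_bipartiteBelow (s := C) (t := univ)
      (fun a y => ¬ G.Adj a y)).symm
  refine le_trans ?_ h1
  have h2 : #E = ∑ x, if x ∈ E then 1 else 0 := by simp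
  have h3 : #U = ∑ x, if x ∈ U then 1 else 0 := by simp
  rw [h2, h3, ← sum_add_distrib]
  refine sum_le_sum fun x _ => ?_
  have hpos : (∃ a ∈ C, ¬ G.Adj a x) → 1 ≤ #{a ∈ C | ¬ G.Adj a x} := fun ⟨a, ha, hax⟩ =>
    card_pos.2 ⟨a, mem_filter.2 ⟨ha, hax⟩⟩
  have hmem : x ∈ E ↔ (x ∈ U → 2 ≤ #{a ∈ C | ¬ G.Adj a x}) ∧
      (x ∉ U → ∃ a ∈ C, ¬ G.Adj a x) := by simp [hE]
  by_cases hxU : x ∈ U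
  · have := hpos (hU x hxU)
    by_cases hxE : x ∈ E
    · have := (hmem.1 hxE).1 hxU
      simp only [hxE, hxU, if_true]
      omega
    · simp only [hxE, hxU, if_true, if_false]
      omega
  · by_cases hxE : x ∈ E
    · have := hpos ((hmem.1 hxE).2 hxU)
      simp only [hxE, hxU, if_true, if_false]
      omega
    · simp [hxE, hxU]

lemma card_le_card_conbrs_add [Fintype V] {C U : Finset V} {D : ℕ}
    (hD : ∀ a ∈ C, #(conbrs G univ a) ≤ D) (hU : ∀ x ∈ U, ∃ a ∈ C, ¬ G.Adj a x) {a : V}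
    (ha : a ∈ C) : #U ≤ #(conbrs G univ a) + (#C - 1) * D := by
  have hsub : U ⊆ C.biUnion (conbrs G univ) := fun x hx => by
    obtain ⟨b, hb, hbx⟩ := hU x hx
    exact mem_biUnion.2 ⟨b, hb, mem_conbrs.2 ⟨mem_univ _, hbx⟩⟩
  refine (card_le_card hsub).trans (card_biUnion_le.trans ?_)
  rw [← add_sum_erase _ _ ha, ← card_erase_of_mem ha, ← smul_eq_mul]
  exact Nat.add_le_add_left (sum_le_card_nsmul _ _ _ fun b hb => hD b (mem_of_mem_erase hb)) _

/-- `c` partially colours `V` with the elements of the `k`-set `C`, in such a way that the colour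
classes have about `|M|` vertices and that `G` is contained in the corresponding block graph, up
to an error `b`. -/
structure IsApproxColoring [Fintype V] (G : SimpleGraph V) (k b : ℕ) (M C : Finset V)
    (c : V → Option V) : Prop where
  card_eq : #C = k
  mem : ∀ x a, c x = some a → a ∈ C
  ne_none : ∀ x ∈ M, c x ≠ none
  card_fibre_le : ∀ a ∈ C, #{x | c x = some a} ≤ #M + b
  le_card_fibre : ∀ a ∈ C, #M ≤ #{x | c x = some a} + b
  exists_exceptional : ∃ B : Finset V, #B ≤ b ∧ ∀ x ∉ B, ∀ y ∉ B, G.Adj x y →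
    (c x = c y → c x = none) ∧ (x ∈ M → c y ≠ none)

omit [DecidableEq V] [DecidableRel G.Adj] in
/-- Every vertex with a non-neighbour in `C` can be coloured by one. -/
lemma exists_choice_coloring (G : SimpleGraph V) (C : Finset V) :
    ∃ c : V → Option V, (∀ x a, c x = some a → a ∈ C ∧ ¬ G.Adj a x) ∧
      ∀ x, c x = none → ∀ a ∈ C, G.Adj a x := by
  have h : ∀ x, ∃ o : Option V, (∀ a, o = some a → a ∈ C ∧ ¬ G.Adj a x) ∧
      (o = none → ∀ a ∈ C, G.Adj a x) := by
    intro x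
    by_cases h : ∃ a ∈ C, ¬ G.Adj a x
    · obtain ⟨a, ha, hax⟩ := h
      exact ⟨some a, fun b hb => by rw [← Option.some.inj hb]; exact ⟨ha, hax⟩, by simp⟩
    · push Not at h
      exact ⟨none, by simp, fun _ => h⟩
  choose c hc using h
  exact ⟨c, fun x => (hc x).1, fun x => (hc x).2⟩

/-- In a colouring by non-neighbours, the class of `a` contains all non-neighbours of `a` but those
with a second non-neighbour in `C`. -/
lemma card_conbrs_le_card_fibre_add [Fintype V] {C E : Finset V} {c : V → Option V}
    (h1 : ∀ x a, c x = some a → a ∈ C ∧ ¬ G.Adj a x) (h2 : ∀ x, c x = none → ∀ a ∈ C, G.Adj a x)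
    (hE : ∀ x ∉ E, ∀ a ∈ C, ∀ b ∈ C, ¬ G.Adj a x → ¬ G.Adj b x → a = b) {a : V} (ha : a ∈ C) :
    #(conbrs G univ a) ≤ #{x | c x = some a} + #E := by
  refine (card_le_card fun x hx => ?_).trans (card_union_le _ _)
  by_cases hxE : x ∈ E
  · exact mem_union_right _ hxE
  · have hax := (mem_conbrs.1 hx).2
    have hne : c x ≠ none := fun h => hax (h2 x h a ha)
    obtain ⟨b, hb⟩ := Option.ne_none_iff_exists'.1 hne
    obtain ⟨hbC, hbx⟩ := h1 x b hb
    rw [hE x hxE b hbC a ha hbx hax] at hb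
    exact mem_union_left _ (by simpa using hb)

/-- Approximately regular graphs contain a clique formed by a vertex of `M` and `k - 1` typical
vertices outside `M`. For this, one takes a vertex with many non-neighbours in `M`, so that
the greedy choice does not run into `M`. -/
lemma NoCliqueMeets.exists_clique_sdiff [Fintype V] {k Δ : ℕ} (hk : 1 ≤ k) {M B : Finset V}
    (hM : NoCliqueMeets G (k + 1) M) (hB : #B ≤ Δ)
    (hA : ∀ a, a ∉ M → a ∉ B → #(conbrs G univ a) ≤ #M + Δ)
    (hdeg : ∀ v ∈ M, v ∉ B → (k - 1) * #M ≤ #(nbrs G univ v) + Δ)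
    (hbig : (k + 1) * (k * Δ + 1) ≤ #M) :
    ∃ v ∈ M, v ∉ B ∧ ∃ S, G.IsNClique (k - 1) S ∧ (∀ a ∈ S, G.Adj v a) ∧
      ∀ a ∈ S, a ∉ M ∧ a ∉ B := by
  set c := #M / (k + 1) with hc
  have hc1 : (k + 1) * c ≤ #M := Nat.mul_div_le _ _
  have hc2 : k * Δ + 1 ≤ c := (Nat.le_div_iff_mul_le (by omega)).2 (by rwa [mul_comm])
  have hΔ : Δ ≤ k * Δ := Nat.le_mul_of_pos_left _ hk
  obtain ⟨v, hv, hvB, hvM⟩ : ∃ v ∈ M, v ∉ B ∧ c < #(conbrs G M v) := by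
    by_contra! hcon
    obtain ⟨Q, hQ, hcl⟩ := exists_isNClique_of_card_conbrs_le (G := G) (A := M \ B) (D := c) (k + 1)
      M (fun a ha => hcon a (mem_sdiff.1 ha).1 (mem_sdiff.1 ha).2) (fun _ => by
        have : #(M \ (M \ B)) ≤ #B := card_le_card fun x hx => by
          simp only [mem_sdiff, not_and, not_not] at hx
          exact hx.2 hx.1
        omega)
    obtain ⟨q, hq⟩ : Q.Nonempty := by rw [← card_pos, hcl.card_eq]; omega
    exact disjoint_left.1 (hM Q hcl) hq (mem_inter.1 (hQ hq)).1
  refine ⟨v, hv, hvB, ?_⟩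
  have hR : #(nbrs G univ v \ (Mᶜ \ B)) ≤ #(nbrs G M v) + #B := by
    refine (card_le_card fun x hx => ?_).trans (card_union_le _ _)
    simp only [mem_sdiff, mem_nbrs, mem_compl, mem_univ, true_and, mem_union] at hx ⊢
    tauto
  have hMv := card_nbrs_add_card_conbrs (G := G) M v
  have hv' := hdeg v hv hvB
  obtain ⟨S, hS, hcl⟩ := exists_isNClique_of_card_conbrs_le (G := G) (A := Mᶜ \ B)
    (D := #M + Δ) (k - 1) (nbrs G univ v)
    (fun a ha => (card_le_card (filter_subset_filter _ (subset_univ _))).trans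
      (hA a (mem_compl.1 (mem_sdiff.1 ha).1) (mem_sdiff.1 ha).2)) (fun _ => by
        have h1 : (k - 1) * (#M + Δ) = (k - 1) * #M + (k - 1) * Δ := by ring
        have h2 : (k - 1) * Δ + Δ = k * Δ := by
          conv_rhs => rw [← Nat.sub_add_cancel hk, add_mul, one_mul]
        omega)
  refine ⟨S, hcl, fun a ha => (mem_nbrs.1 (mem_inter.1 (hS ha)).1).2, fun a ha => ?_⟩
  have := mem_sdiff.1 (mem_inter.1 (hS ha)).2
  exact ⟨mem_compl.1 this.1, this.2⟩

/-- If almost all vertices satisfy the degree conditions of the extremal graphs approximately, then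
`G` is almost contained in a block graph. -/
theorem NoCliqueMeets.exists_isApproxColoring [Fintype V] {k Δ : ℕ} (hk : 1 ≤ k) {M B : Finset V}
    (hM : NoCliqueMeets G (k + 1) M) (hB : #B ≤ Δ)
    (hA : ∀ a, a ∉ M → a ∉ B → #(conbrs G univ a) ≤ #M + Δ)
    (hdeg : ∀ v ∈ M, v ∉ B → (k - 1) * #M ≤ #(nbrs G univ v) + Δ)
    (hbig : (k + 1) * (k * Δ + 1) ≤ #M) :
    ∃ C c, IsApproxColoring G k (6 * (k * Δ)) M C c := by
  obtain ⟨v, hv, hvB, S, hS, hSv, hSA⟩ := hM.exists_clique_sdiff hk hB hA hdeg hbig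
  have hΔ : Δ ≤ k * Δ := Nat.le_mul_of_pos_left _ hk
  have hkm : (k - 1) * #M + #M = k * #M := by
    conv_rhs => rw [← Nat.sub_add_cancel hk, add_mul, one_mul]
  have hkΔ : (k - 1) * Δ + Δ = k * Δ := by
    conv_rhs => rw [← Nat.sub_add_cancel hk, add_mul, one_mul]
  have hSD : ∀ a ∈ S, #(conbrs G univ a) ≤ #M + Δ := fun a ha => hA a (hSA a ha).1 (hSA a ha).2
  set N := nbrs G univ v with hN
  have hNmem : ∀ x, x ∈ N ↔ G.Adj v x := by simp [hN, mem_nbrs]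
  have hNW : ∀ x ∈ N, ∃ a ∈ S, ¬ G.Adj a x := fun x hx =>
    hM.exists_not_adj_of_adj hk hS hv hSv ((hNmem x).1 hx)
  have hNc : (k - 1) * #M ≤ #N + Δ := hdeg v hv hvB
  set W : Finset V := {x | ∃ a ∈ S, ¬ G.Adj a x} with hW
  have hWmem : ∀ x, x ∈ W ↔ ∃ a ∈ S, ¬ G.Adj a x := by simp [hW]
  have hE := card_exceptional_add_card_le hSD hNW
  set E : Finset V :=
    {x | (x ∈ N → 2 ≤ #{a ∈ S | ¬ G.Adj a x}) ∧ (x ∉ N → ∃ a ∈ S, ¬ G.Adj a x)} with hEdef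
  rw [hS.card_eq, mul_add] at hE
  have hEc : #E ≤ k * Δ := by omega
  have hEN : ∀ x ∉ E, x ∈ W → x ∈ N := by
    intro x hx hxW
    by_contra hxN
    exact hx (by simp only [hEdef, mem_filter, mem_univ, true_and]
                 exact ⟨fun h => absurd h hxN, fun _ => (hWmem x).1 hxW⟩)
  have hEuniq : ∀ x ∉ E, ∀ a ∈ S, ∀ b ∈ S, ¬ G.Adj a x → ¬ G.Adj b x → a = b := by
    intro x hx a ha b hb hax hbx
    have hxN := hEN x hx ((hWmem x).2 ⟨a, ha, hax⟩)
    have hlt : #{a ∈ S | ¬ G.Adj a x} ≤ 1 := by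
      by_contra! h
      exact hx (by simp only [hEdef, mem_filter, mem_univ, true_and]
                   exact ⟨fun _ => h, fun h => absurd hxN h⟩)
    exact card_le_one.1 hlt a (mem_filter.2 ⟨ha, hax⟩) b (mem_filter.2 ⟨hb, hbx⟩)
  -- The non-neighbourhoods of the vertices of `S` are essentially independent sets.
  have hindep : ∀ x ∉ E, ∀ y ∉ E, ∀ a ∈ S, ¬ G.Adj a x → ¬ G.Adj a y → ¬ G.Adj x y := by
    intro x hx y hy a ha hax hay hxy
    have hxN := hEN x hx ((hWmem x).2 ⟨a, ha, hax⟩)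
    have hyN := hEN y hy ((hWmem y).2 ⟨a, ha, hay⟩)
    have hS' := hS.insert_erase (a := x) (b := a) (fun w hw => by
      obtain ⟨hw, hwa⟩ := mem_sdiff.1 hw
      by_contra h
      exact hwa (mem_singleton.2 (hEuniq x hx w hw a ha (fun h' => h h'.symm) hax))) ha
    obtain ⟨b, hb, hby⟩ := hM.exists_not_adj_of_adj hk hS' hv (fun w hw => by
      rcases mem_insert.1 hw with rfl | hw
      · exact (hNmem _).1 hxN
      · exact hSv w (mem_of_mem_erase hw)) ((hNmem y).1 hyN)
    rcases mem_insert.1 hb with rfl | hb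
    · exact hby hxy
    · obtain ⟨hba, hb⟩ := mem_erase.1 hb
      exact hba (hEuniq y hy b hb a ha hby hay)
  obtain ⟨c, hc1, hc2⟩ := exists_choice_coloring G S
  by_cases hMW : #(M ∩ W) ≤ 3 * (k * Δ)
  · -- Almost all of `M` lies in one class, which becomes the class of `v`.
    have hvS : v ∉ S := fun h => (hSA v h).1 hv
    have hcW : ∀ x, c x ≠ none ↔ x ∈ W := by
      intro x
      rw [hWmem]
      constructor
      · intro h
        obtain ⟨a, ha⟩ := Option.ne_none_iff_exists'.1 h
        exact ⟨a, hc1 x a ha⟩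
      · rintro ⟨a, ha, hax⟩ h
        exact hax (hc2 x h a ha)
    let c' : V → Option V := fun x => if x ∈ M \ W then some v else c x
    have hc'in : ∀ x, x ∈ M \ W → c' x = some v := fun x hx => if_pos hx
    have hc'out : ∀ x, x ∉ M \ W → c' x = c x := fun x hx => if_neg hx
    have hfib : ∀ a ∈ S, ({x | c' x = some a} : Finset V) = ({x | c x = some a} : Finset V) := by
      intro a ha
      ext x
      simp only [mem_filter, mem_univ, true_and]
      by_cases hx : x ∈ M \ W
      · rw [hc'in x hx]
        refine ⟨fun h => absurd (Option.some.inj h ▸ ha) hvS, fun h => ?_⟩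
        exact absurd ((hcW x).1 (by simp [h])) (mem_sdiff.1 hx).2
      · rw [hc'out x hx]
    have hfibv : ({x | c' x = some v} : Finset V) = M \ W := by
      ext x
      simp only [mem_filter, mem_univ, true_and]
      refine ⟨fun h => ?_, hc'in x⟩
      by_contra hx
      rw [hc'out x hx] at h
      exact hvS (hc1 x v h).1
    have hMsplit := card_sdiff_add_card_inter M W
    refine ⟨insert v S, c', ?_, ?_, ?_, ?_, ?_, E ∪ (M ∩ W), ?_, ?_⟩
    · rw [card_insert_of_notMem hvS, hS.card_eq, Nat.sub_add_cancel hk]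
    · intro x a hxa
      by_cases hx : x ∈ M \ W
      · rw [hc'in x hx] at hxa
        exact Option.some.inj hxa ▸ mem_insert_self _ _
      · rw [hc'out x hx] at hxa
        exact mem_insert_of_mem (hc1 x a hxa).1
    · intro x hx
      by_cases hx' : x ∈ M \ W
      · simp [hc'in x hx']
      · rw [hc'out x hx', hcW]
        by_contra h
        exact hx' (mem_sdiff.2 ⟨hx, h⟩)
    · intro a ha
      rcases mem_insert.1 ha with rfl | ha
      · rw [hfibv]
        omega
      · rw [hfib a ha]
        have : #{x | c x = some a} ≤ #(conbrs G univ a) := card_le_card fun x hx =>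
          mem_conbrs.2 ⟨mem_univ _, (hc1 x a (by simpa using hx)).2⟩
        have := hSD a ha
        omega
    · intro a ha
      rcases mem_insert.1 ha with rfl | ha
      · rw [hfibv]
        omega
      · rw [hfib a ha]
        have h1 := card_conbrs_le_card_fibre_add hc1 hc2 hEuniq ha
        have h2 := card_le_card_conbrs_add hSD hNW ha
        obtain ⟨l, hl⟩ : ∃ l, k = l + 2 := by
          have : 0 < #S := card_pos.2 ⟨a, ha⟩
          rw [hS.card_eq] at this
          exact ⟨k - 2, by omega⟩
        rw [hS.card_eq] at h2
        subst hl
        simp only [Nat.add_sub_cancel, show l + 2 - 1 = l + 1 by omega] at h2 hNc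
        nlinarith
    · have := card_union_le E (M ∩ W)
      omega
    · intro x hx y hy hxy
      rw [notMem_union] at hx hy
      have hout : ∀ z w, z ∈ M \ W → G.Adj z w → w ∈ W := by
        intro z w hz hzw
        obtain ⟨hzM, hzW⟩ := mem_sdiff.1 hz
        rw [hWmem] at hzW
        push Not at hzW
        exact (hWmem w).2 (hM.exists_not_adj_of_adj hk hS hzM (fun a ha => (hzW a ha).symm) hzw)
      refine ⟨fun hc => ?_, fun hxM => ?_⟩
      · by_contra hne
        obtain ⟨a, ha⟩ := Option.ne_none_iff_exists'.1 hne
        have hx' : x ∉ M \ W := by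
          intro hx'
          have hy' : y ∈ M \ W := by
            rw [hc'in x hx'] at hc
            rw [← hfibv]
            simpa using hc.symm
          exact (mem_sdiff.1 hy').2 (hout x y hx' hxy)
        have hy' : y ∉ M \ W := by
          intro hy'
          refine hx' ?_
          rw [hc'in y hy'] at hc
          rw [← hfibv]
          simpa using hc
        rw [hc'out x hx', hc'out y hy'] at hc
        rw [hc'out x hx'] at ha
        obtain ⟨haS, hax⟩ := hc1 x a ha
        obtain ⟨-, hay⟩ := hc1 y a (hc ▸ ha)
        exact hindep x hx.1 y hy.1 a haS hax hay hxy
      · have hxW : x ∉ W := fun h => hx.2 (mem_inter.2 ⟨hxM, h⟩)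
        have hyW := hout x y (mem_sdiff.2 ⟨hxM, hxW⟩) hxy
        rw [hc'out y fun h => (mem_sdiff.1 h).2 hyW, hcW]
        exact hyW
  · -- Otherwise a vertex of `M` in one of these classes leads to a further class and a `k`-clique
    -- `insert a₁ S` disjoint from `M`.
    push Not at hMW
    obtain ⟨w, hw, hwEB⟩ : ∃ w ∈ M ∩ W, w ∉ E ∪ B := by
      by_contra! hcon
      have := card_le_card hcon
      have := card_union_le E B
      omega
    obtain ⟨hwM, hwW⟩ := mem_inter.1 hw
    rw [notMem_union] at hwEB
    obtain ⟨a₀, ha₀, ha₀w⟩ := (hWmem w).1 hwW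
    obtain ⟨l, hl⟩ : ∃ l, k = l + 2 := by
      have : 0 < #S := card_pos.2 ⟨a₀, ha₀⟩
      rw [hS.card_eq] at this
      exact ⟨k - 2, by omega⟩
    have hwS : ∀ b ∈ S.erase a₀, G.Adj w b := by
      intro b hb
      obtain ⟨hba, hb⟩ := mem_erase.1 hb
      by_contra h
      exact hba (hEuniq w hwEB.1 b hb a₀ ha₀ (fun h' => h h'.symm) ha₀w)
    set X : Finset V := {y | G.Adj w y ∧ ∀ b ∈ S.erase a₀, G.Adj b y} with hX
    have hXmem : ∀ y, y ∈ X ↔ G.Adj w y ∧ ∀ b ∈ S.erase a₀, G.Adj b y := by simp [hX]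
    have hXc : #M ≤ #X + (k - 1) * Δ := by
      have hsub : nbrs G univ w ⊆ X ∪ (S.erase a₀).biUnion (conbrs G univ) := by
        intro y hy
        have hwy := (mem_nbrs.1 hy).2
        by_cases h : ∀ b ∈ S.erase a₀, G.Adj b y
        · exact mem_union_left _ ((hXmem y).2 ⟨hwy, h⟩)
        · push Not at h
          obtain ⟨b, hb, hby⟩ := h
          exact mem_union_right _ (mem_biUnion.2 ⟨b, hb, mem_conbrs.2 ⟨mem_univ _, hby⟩⟩)
      have h1 := (card_le_card hsub).trans (card_union_le _ _)
      have h2 : #((S.erase a₀).biUnion (conbrs G univ)) ≤ (k - 2) * (#M + Δ) := by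
        refine card_biUnion_le.trans ?_
        have : #(S.erase a₀) = k - 2 := by
          rw [card_erase_of_mem ha₀, hS.card_eq]
          omega
        rw [← this, ← smul_eq_mul]
        exact sum_le_card_nsmul _ _ _ fun b hb => hSD b (mem_of_mem_erase hb)
      have h3 := hdeg w hwM hwEB.2
      subst hl
      simp only [Nat.add_sub_cancel, show l + 2 - 1 = l + 1 by omega] at h1 h2 h3 ⊢
      nlinarith
    have hXindep : ∀ x ∈ X, ∀ y ∈ X, ¬ G.Adj x y := by
      intro x hx y hy hxy
      obtain ⟨hwx, hxS⟩ := (hXmem x).1 hx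
      obtain ⟨hwy, hyS⟩ := (hXmem y).1 hy
      have hS' := hS.insert_erase (a := x) (b := a₀) (fun b hb => by
        obtain ⟨hb, hba⟩ := mem_sdiff.1 hb
        exact (hxS b (mem_erase.2 ⟨fun h => hba (mem_singleton.2 h), hb⟩)).symm) ha₀
      obtain ⟨b, hb, hby⟩ := hM.exists_not_adj_of_adj hk hS' hwM (fun b hb => by
        rcases mem_insert.1 hb with rfl | hb
        · exact hwx
        · exact hwS b hb) hwy
      rcases mem_insert.1 hb with rfl | hb
      · exact hby hxy
      · exact hby (hyS b hb)
    have hXW : ∀ x ∈ X, x ∈ W → x ∈ E := by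
      intro x hx hxW
      by_contra hxE
      obtain ⟨hwx, hxS⟩ := (hXmem x).1 hx
      obtain ⟨a, ha, hax⟩ := (hWmem x).1 hxW
      have : a = a₀ := by
        by_contra hne
        exact hax (hxS a (mem_erase.2 ⟨hne, ha⟩))
      subst this
      exact hindep w hwEB.1 x hxE a ha ha₀w hax hwx
    obtain ⟨a₁, ha₁X, ha₁W, ha₁M, ha₁B⟩ : ∃ a₁ ∈ X, a₁ ∉ W ∧ a₁ ∉ M ∧ a₁ ∉ B := by
      by_contra! hcon
      have hsub : X ⊆ E ∪ ((M \ W) ∪ B) := by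
        intro x hx
        by_cases hxW : x ∈ W
        · exact mem_union_left _ (hXW x hx hxW)
        · refine mem_union_right _ ?_
          by_cases hxM : x ∈ M
          · exact mem_union_left _ (mem_sdiff.2 ⟨hxM, hxW⟩)
          · exact mem_union_right _ (hcon x hx hxW hxM)
      have h1 := (card_le_card hsub).trans (card_union_le _ _)
      have h2 := card_union_le (M \ W) B
      have h3 := card_sdiff_add_card_inter M W
      omega
    have ha₁S : ∀ a ∈ S, G.Adj a₁ a := by
      intro a ha
      by_contra h
      exact ha₁W ((hWmem a₁).2 ⟨a, ha, fun h' => h h'.symm⟩)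
    have hC := hS.insert ha₁S
    rw [Nat.sub_add_cancel hk] at hC
    set C := insert a₁ S with hCdef
    have ha₁C : a₁ ∈ C := mem_insert_self _ _
    have hCD : ∀ a ∈ C, #(conbrs G univ a) ≤ #M + Δ := by
      intro a ha
      rcases mem_insert.1 ha with rfl | ha
      · exact hA _ ha₁M ha₁B
      · exact hSD a ha
    have hXa₁ : ∀ x ∈ X, ¬ G.Adj a₁ x := fun x hx => hXindep a₁ ha₁X x hx
    set U := N ∪ (X \ E) with hU
    have hUC : ∀ x ∈ U, ∃ a ∈ C, ¬ G.Adj a x := by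
      intro x hx
      rcases mem_union.1 hx with hx | hx
      · obtain ⟨a, ha, hax⟩ := hNW x hx
        exact ⟨a, mem_insert_of_mem ha, hax⟩
      · exact ⟨a₁, ha₁C, hXa₁ x (mem_sdiff.1 hx).1⟩
    have hUc : k * #M ≤ #U + 2 * (k * Δ) := by
      have hdisj : Disjoint N (X \ E) := disjoint_left.2 fun x hxN hx => by
        obtain ⟨hxX, hxE⟩ := mem_sdiff.1 hx
        exact hxE (hXW x hxX ((hWmem x).2 (hNW x hxN)))
      rw [hU, card_union_of_disjoint hdisj]
      have := le_card_sdiff E X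
      omega
    have hF := card_exceptional_add_card_le hCD hUC
    set F : Finset V :=
      {x | (x ∈ U → 2 ≤ #{a ∈ C | ¬ G.Adj a x}) ∧ (x ∉ U → ∃ a ∈ C, ¬ G.Adj a x)} with hFdef
    rw [hC.card_eq, mul_add] at hF
    have hFc : #F ≤ 3 * (k * Δ) := by omega
    have hFuniq : ∀ x ∉ F, ∀ a ∈ C, ∀ b ∈ C, ¬ G.Adj a x → ¬ G.Adj b x → a = b := by
      intro x hx a ha b hb hax hbx
      have hlt : #{a ∈ C | ¬ G.Adj a x} ≤ 1 := by
        by_contra! h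
        exact hx (by simp only [hFdef, mem_filter, mem_univ, true_and]
                     exact ⟨fun _ => h, fun _ => ⟨a, ha, hax⟩⟩)
      exact card_le_one.1 hlt a (mem_filter.2 ⟨ha, hax⟩) b (mem_filter.2 ⟨hb, hbx⟩)
    have hres : #(conbrs G univ a₁ \ X) ≤ k * Δ := by
      have hsub : X ⊆ conbrs G univ a₁ := fun x hx => mem_conbrs.2 ⟨mem_univ _, hXa₁ x hx⟩
      have := hCD a₁ ha₁C
      rw [card_sdiff_of_subset hsub]
      omega
    obtain ⟨c, hc1, hc2⟩ := exists_choice_coloring G C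
    refine ⟨C, c, hC.card_eq, fun x a h => (hc1 x a h).1, ?_, ?_, ?_,
      E ∪ (F ∪ (conbrs G univ a₁ \ X)), ?_, ?_⟩
    · intro x hx hcx
      exact disjoint_left.1 (hM _ (hC.insert fun a ha => (hc2 x hcx a ha).symm))
        (mem_insert_self _ _) hx
    · intro a ha
      have : #{x | c x = some a} ≤ #(conbrs G univ a) := card_le_card fun x hx =>
        mem_conbrs.2 ⟨mem_univ _, (hc1 x a (by simpa using hx)).2⟩
      have := hCD a ha
      omega
    · intro a ha
      have h1 := card_conbrs_le_card_fibre_add hc1 hc2 hFuniq ha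
      have h2 := card_le_card_conbrs_add hCD hUC ha
      rw [hC.card_eq, mul_add] at h2
      omega
    · have h1 := card_union_le E (F ∪ (conbrs G univ a₁ \ X))
      have h2 := card_union_le F (conbrs G univ a₁ \ X)
      omega
    · intro x hx y hy hxy
      simp only [notMem_union] at hx hy
      refine ⟨fun hc => ?_, fun hxM hcy => ?_⟩
      · by_contra hne
        obtain ⟨a, ha⟩ := Option.ne_none_iff_exists'.1 hne
        obtain ⟨haC, hax⟩ := hc1 x a ha
        obtain ⟨-, hay⟩ := hc1 y a (hc ▸ ha)
        rcases mem_insert.1 haC with rfl | haS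
        · have hmem : ∀ z, ¬ G.Adj a z → z ∉ conbrs G univ a \ X → z ∈ X := by
            intro z hz hz'
            by_contra hzX
            exact hz' (mem_sdiff.2 ⟨mem_conbrs.2 ⟨mem_univ _, hz⟩, hzX⟩)
          exact hXindep x (hmem x hax hx.2.2) y (hmem y hay hy.2.2) hxy
        · exact hindep x hx.1 y hy.1 a haS hax hay hxy
      · obtain ⟨a, ha, hax⟩ : ∃ a ∈ C, ¬ G.Adj a x := by
          by_contra! h
          exact disjoint_left.1 (hM _ (hC.insert fun a ha => (h a ha).symm))
            (mem_insert_self _ _) hxM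
        have hC' := hC.insert_erase (a := x) (b := a) (fun b hb => by
          obtain ⟨hb, hba⟩ := mem_sdiff.1 hb
          by_contra h
          exact hba (mem_singleton.2
            (hFuniq x hx.2.1 b hb a ha (fun h' => h h'.symm) hax))) ha
        obtain ⟨b, hb, hby⟩ := hM.exists_not_adj hC' (mem_insert_self _ _) hxM y
        rcases mem_insert.1 hb with rfl | hb
        · exact hby hxy
        · exact hby (hc2 y hcy b (mem_of_mem_erase hb))

/-! ### Atypical vertices -/

lemma adjPairs_le_adjPairs_sdiff (T S : Finset V) (hS : S ⊆ T) :
    adjPairs G T ≤ adjPairs G (T \ S) + 2 * ∑ x ∈ S, #(nbrs G T x) := by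
  induction S using Finset.induction_on with
  | empty => simp
  | insert x S hx ih =>
    have hxT := hS (mem_insert_self x S)
    have ih := ih ((subset_insert x S).trans hS)
    have h1 := adjPairs_erase (G := G) (mem_sdiff.2 ⟨hxT, hx⟩)
    have h2 : #(nbrs G (T \ S) x) ≤ #(nbrs G T x) :=
      card_le_card (filter_subset_filter _ sdiff_subset)
    rw [sum_insert hx, sdiff_insert]
    omega

/-- Vertices outside `M` of low degree push the number of edges below the bound. -/
lemma NoCliqueMeets.adjPairs_add_le_of_sdiff [Fintype V] {k Δ : ℕ} (hk : 1 ≤ k) {M S : Finset V}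
    (hM : NoCliqueMeets G (k + 1) M) (hS : Disjoint S M)
    (hdeg : ∀ x ∈ S, #M + Δ < #(conbrs G univ x)) :
    (adjPairs G univ : ℤ) + #S * (2 * Δ + 1 - #S) ≤ twoTurm k (Fintype.card V) #M := by
  have hMS : M ⊆ univ \ S := fun x hx => mem_sdiff.2 ⟨mem_univ _, fun h => disjoint_left.1 hS h hx⟩
  have h1 := hM.adjPairs_le_twoTurm hk hMS
  have h2 := adjPairs_le_adjPairs_sdiff (G := G) univ S (subset_univ _)
  have h3 : ∑ x ∈ S, (#(nbrs G univ x) : ℤ) ≤ #S * (Fintype.card V - #M - Δ - 1) := by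
    rw [← nsmul_eq_mul]
    refine sum_le_card_nsmul _ _ _ fun x hx => ?_
    have h4 := card_nbrs_add_card_conbrs (G := G) univ x
    have h5 := hdeg x hx
    rw [card_univ] at h4
    zify at h4 h5
    linarith
  have h6 := card_sdiff_add_card_eq_card (subset_univ S)
  rw [card_univ] at h6
  zify at h2 h6
  rw [show (#(univ \ S) : ℤ) = Fintype.card V - #S by linarith] at h1
  unfold twoTurm at h1 ⊢
  nlinarith

/-- Vertices of `M` of low degree push the number of edges below the bound. -/
lemma NoCliqueMeets.adjPairs_add_le_of_subset [Fintype V] {k Δ : ℕ} (hk : 1 ≤ k) {M S : Finset V}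
    (hM : NoCliqueMeets G (k + 1) M) (hS : S ⊆ M)
    (hdeg : ∀ x ∈ S, #(nbrs G univ x) + Δ < (k - 1) * #M) :
    (adjPairs G univ : ℤ) + #S * (2 * Δ + 2 - (k - 1) * (#S - 1)) ≤
      twoTurm k (Fintype.card V) #M := by
  have h1 := (hM.mono (sdiff_subset (s := M) (t := S))).adjPairs_le_twoTurm hk
    (sdiff_subset_sdiff (subset_univ M) (subset_refl S))
  have h2 := adjPairs_le_adjPairs_sdiff (G := G) univ S (subset_univ _)
  have h3 : ∑ x ∈ S, (#(nbrs G univ x) : ℤ) ≤ #S * ((k - 1) * #M - Δ - 1) := by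
    rw [← nsmul_eq_mul]
    refine sum_le_card_nsmul _ _ _ fun x hx => ?_
    have h5 := hdeg x hx
    zify [hk] at h5
    linarith
  have h6 := card_sdiff_add_card_eq_card (subset_univ S)
  have h7 := card_sdiff_add_card_eq_card hS
  rw [card_univ] at h6
  zify at h2 h6 h7
  rw [show (#(univ \ S) : ℤ) = Fintype.card V - #S by linarith,
    show (#(M \ S) : ℤ) = #M - #S by linarith] at h1
  unfold twoTurm at h1 ⊢
  nlinarith

/-- Almost all vertices of a nearly extremal graph satisfy the degree conditions: deleting `b`
vertices that violate them would leave a graph with too many edges. -/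
lemma NoCliqueMeets.exists_atypical [Fintype V] {k b Δ : ℕ} (hk : 1 ≤ k) {M : Finset V}
    (hM : NoCliqueMeets G (k + 1) M) (hb : 2 * k * b ≤ Δ)
    (hE : twoTurm k (Fintype.card V) #M < adjPairs G univ + b * Δ) :
    ∃ B : Finset V, #B ≤ Δ ∧ (∀ a, a ∉ M → a ∉ B → #(conbrs G univ a) ≤ #M + Δ) ∧
      ∀ v ∈ M, v ∉ B → (k - 1) * #M ≤ #(nbrs G univ v) + Δ := by
  have hbΔ : 2 * b ≤ Δ := le_trans (Nat.mul_le_mul_right b (by omega)) hb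
  set B₁ : Finset V := {a | a ∉ M ∧ #M + Δ < #(conbrs G univ a)} with hB₁
  set B₂ : Finset V := {v ∈ M | #(nbrs G univ v) + Δ < (k - 1) * #M} with hB₂
  have h1 : #B₁ < b := by
    by_contra! h
    obtain ⟨S, hS, hSc⟩ := exists_subset_card_eq h
    have hmem : ∀ x ∈ S, x ∉ M ∧ #M + Δ < #(conbrs G univ x) := fun x hx => by
      simpa [hB₁] using hS hx
    have := hM.adjPairs_add_le_of_sdiff hk (disjoint_left.2 fun x hx => (hmem x hx).1)
      fun x hx => (hmem x hx).2
    rw [hSc] at this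
    zify at hbΔ
    nlinarith
  have h2 : #B₂ < b := by
    by_contra! h
    obtain ⟨S, hS, hSc⟩ := exists_subset_card_eq h
    have hmem : ∀ x ∈ S, x ∈ M ∧ #(nbrs G univ x) + Δ < (k - 1) * #M := fun x hx => by
      simpa [hB₂] using hS hx
    have := hM.adjPairs_add_le_of_subset hk (fun x hx => (hmem x hx).1) fun x hx => (hmem x hx).2
    rw [hSc] at this
    zify at hb hk
    have h3 : ((k : ℤ) - 1) * (b - 1) ≤ Δ := by nlinarith
    nlinarith
  refine ⟨B₁ ∪ B₂, ?_, fun a ha haB => ?_, fun v hv hvB => ?_⟩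
  · have := card_union_le B₁ B₂
    omega
  · by_contra! h
    exact haB (mem_union_left _ (by simp [hB₁, ha, h]))
  · by_contra! h
    exact hvB (mem_union_right _ (by simp [hB₂, hv, h]))

/-! ### Adjusting the class sizes -/

/-- A partial colouring can be changed in few places to make all classes have exactly `m`
vertices, without uncolouring a vertex of `M`. -/
lemma exists_recoloring [Fintype V] {k m : ℕ} {M : Finset V} (hM : #M ≤ m)
    (hcard : k * m ≤ Fintype.card V) (d : ℕ) :
    ∀ col : V → Option (Fin k), (∀ x ∈ M, col x ≠ none) →
      ∑ i, ((#{x | col x = some i} - m) + (m - #{x | col x = some i})) = d →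
      ∃ col' : V → Option (Fin k), (∀ x ∈ M, col' x ≠ none) ∧
        (∀ i, #{x | col' x = some i} = m) ∧ #{x | col' x ≠ col x} ≤ d := by
  induction d with
  | zero =>
    intro col hcol hd
    refine ⟨col, hcol, fun i => ?_, by simp⟩
    have := (sum_eq_zero_iff.1 hd) i (mem_univ _)
    omega
  | succ d ih =>
    intro col hcol hd
    -- Changing the colour of a single vertex `x` in the right direction suffices.
    have key : ∀ x c i, col x ≠ c → (x ∈ M → c ≠ none) →
        (∀ j ≠ i, #{y | Function.update col x c y = some j} = #{y | col y = some j}) →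
        (#{y | Function.update col x c y = some i} - m) +
          (m - #{y | Function.update col x c y = some i}) + 1 =
          (#{y | col y = some i} - m) + (m - #{y | col y = some i}) →
        ∃ col' : V → Option (Fin k), (∀ x ∈ M, col' x ≠ none) ∧
          (∀ i, #{x | col' x = some i} = m) ∧ #{x | col' x ≠ col x} ≤ d + 1 := by
      intro x c i hxc hxM hj hi
      obtain ⟨col', h1, h2, h3⟩ := ih (Function.update col x c) (fun y hy => by
        by_cases hyx : y = x
        · subst hyx
          rw [Function.update_self]
          exact hxM hy
        · rw [Function.update_of_ne hyx]
          exact hcol y hy) (by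
        rw [← add_sum_erase _ _ (mem_univ i)] at hd ⊢
        rw [sum_congr rfl fun j hj' => by rw [hj j (ne_of_mem_erase hj')]]
        omega)
      refine ⟨col', h1, h2, ?_⟩
      have hsub : ({y | col' y ≠ col y} : Finset V) ⊆
          insert x ({y | col' y ≠ Function.update col x c y} : Finset V) := by
        intro y hy
        by_cases hyx : y = x
        · exact hyx ▸ mem_insert_self _ _
        · refine mem_insert_of_mem ?_
          simpa [Function.update_of_ne hyx] using hy
      exact (card_le_card hsub).trans ((card_insert_le _ _).trans (Nat.add_le_add_right h3 1))
    by_cases hbig : ∃ i, m < #{x | col x = some i}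
    · obtain ⟨i, hi⟩ := hbig
      obtain ⟨x, hx, hxM⟩ := exists_mem_notMem_of_card_lt_card (hM.trans_lt hi)
      have hxi : col x = some i := by simpa using hx
      refine key x none i (by simp [hxi]) (fun h => absurd h hxM) (fun j hji => ?_) ?_
      · congr 1
        refine filter_congr fun y _ => ?_
        by_cases hyx : y = x
        · subst hyx
          simp [hxi, hji.symm]
        · rw [Function.update_of_ne hyx]
      · have : ({y | Function.update col x none y = some i} : Finset V) =
            (univ.filter (fun y => col y = some i)).erase x := by
          ext y
          by_cases hyx : y = x
          · subst hyx
            simp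
          · simp [hyx]
        rw [this, card_erase_of_mem hx]
        omega
    · push Not at hbig
      obtain ⟨i, hi⟩ : ∃ i, #{x | col x = some i} < m := by
        by_contra! h
        rw [sum_eq_zero fun i _ => by have := hbig i; have := h i; omega] at hd
        omega
      obtain ⟨x, hx⟩ : ∃ x, col x = none := by
        by_contra! h
        have h1 := card_eq_sum_card_fiberwise (f := col) (s := univ) (t := univ) (by simp)
        rw [Fintype.sum_option, card_univ, filter_false_of_mem fun x _ => h x, card_empty,
          zero_add] at h1
        have h2 : ∑ j : Fin k, #{x | col x = some j} < ∑ j : Fin k, m :=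
          sum_lt_sum (fun j _ => hbig j) ⟨i, mem_univ _, hi⟩
        simp only [sum_const, card_univ, Fintype.card_fin, smul_eq_mul] at h2
        omega
      refine key x (some i) i (by simp [hx]) (fun _ => by simp) (fun j hji => ?_) ?_
      · congr 1
        refine filter_congr fun y _ => ?_
        by_cases hyx : y = x
        · subst hyx
          simp [hx, hji.symm]
        · rw [Function.update_of_ne hyx]
      · have : ({y | Function.update col x (some i) y = some i} : Finset V) =
            insert x (univ.filter (fun y => col y = some i)) := by
          ext y
          by_cases hyx : y = x
          · subst hyx
            simp
          · simp [hyx]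
        rw [this, card_insert_of_notMem (by simp [hx])]
        omega

/-- A nearly extremal graph is contained in a block graph with classes of size `|M|`, up to the
edges at few vertices. -/
theorem NoCliqueMeets.exists_coloring [Fintype V] {k b Δ : ℕ} (hk : 1 ≤ k) {M : Finset V}
    (hM : NoCliqueMeets G (k + 1) M) (hcard : k * #M ≤ Fintype.card V) (hb : 2 * k * b ≤ Δ)
    (hE : twoTurm k (Fintype.card V) #M < adjPairs G univ + b * Δ) :
    ∃ col : V → Option (Fin k), (∀ x ∈ M, col x ≠ none) ∧ (∀ i, #{x | col x = some i} = #M) ∧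
      ∃ B : Finset V, #B ≤ k * (k + 1) * ((k + 12) * Δ + 1) ∧
        ∀ x ∉ B, ∀ y ∉ B, G.Adj x y → (blockGraph col M).Adj x y := by
  rcases le_or_gt ((k + 1) * (k * Δ + 1)) #M with hbig | hsmall
  · obtain ⟨B, hB, hA, hdeg⟩ := hM.exists_atypical hk hb hE
    obtain ⟨C, c, h⟩ := hM.exists_isApproxColoring hk hB hA hdeg hbig
    let e : C ≃ Fin k := C.equivFinOfCardEq h.card_eq
    let f : V → Fin k := fun x => if hx : x ∈ C then e ⟨x, hx⟩ else ⟨0, hk⟩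
    have hf : ∀ a (ha : a ∈ C), f a = e ⟨a, ha⟩ := fun a ha => dif_pos ha
    have hfib : ∀ i, ({x | (c x).map f = some i} : Finset V) =
        univ.filter (fun x => c x = some (e.symm i).1) := by
      intro i
      refine filter_congr fun x _ => ?_
      rw [Option.map_eq_some_iff]
      constructor
      · rintro ⟨a, ha, hai⟩
        have haC := h.mem x a ha
        rw [hf a haC] at hai
        rw [ha, ← hai, e.symm_apply_apply]
      · intro hx
        refine ⟨_, hx, ?_⟩
        rw [hf _ (e.symm i).2, Subtype.coe_eta, e.apply_symm_apply]
    obtain ⟨col, h1, h2, h3⟩ := exists_recoloring (M := M) le_rfl hcard _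
      (fun x => (c x).map f) (fun x hx => by simpa using h.ne_none x hx) rfl
    have h4 : ∑ i : Fin k, ((#{x | (c x).map f = some i} - #M) +
        (#M - #{x | (c x).map f = some i})) ≤ k * (6 * (k * Δ)) := by
      have := sum_le_card_nsmul (univ : Finset (Fin k)) (fun i =>
        (#{x | (c x).map f = some i} - #M) + (#M - #{x | (c x).map f = some i}))
        (6 * (k * Δ)) (fun i _ => by
          have h5 := h.card_fibre_le _ (e.symm i).2
          have h6 := h.le_card_fibre _ (e.symm i).2
          simp only [hfib i]
          omega)
      simpa using this
    obtain ⟨B', hB'c, hB'⟩ := h.exists_exceptional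
    refine ⟨col, h1, h2, B' ∪ ({x | col x ≠ (c x).map f} : Finset V), ?_, ?_⟩
    · have h5 := card_union_le B' ({x | col x ≠ (c x).map f} : Finset V)
      have h6 := h3.trans h4
      nlinarith [Nat.zero_le (k * (k + 1) * (k * Δ)), Nat.zero_le (k * k * Δ)]
    · intro x hx y hy hxy
      simp only [notMem_union, mem_filter, mem_univ, true_and, ne_eq, not_not] at hx hy
      have h5 := hB' x hx.1 y hy.1 hxy
      have h6 := hB' y hy.1 x hx.1 hxy.symm
      rw [blockGraph_adj, hx.2, hy.2]
      refine ⟨hxy.ne, fun hc => ?_, ?_, ?_⟩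
      · rcases hcx : c x with _ | a
        · rfl
        · rcases hcy : c y with _ | a'
          · rw [hcx, hcy] at hc
            simp at hc
          · have haC := h.mem x a hcx
            have haC' := h.mem y a' hcy
            rw [hcx, hcy, Option.map_some, Option.map_some, Option.some_inj, hf a haC,
              hf a' haC', e.apply_eq_iff_eq, Subtype.mk.injEq] at hc
            have := h5.1 (by rw [hcx, hcy, hc])
            rw [hcx] at this
            simp at this
      · simpa using h5.2
      · simpa using h6.2
  · -- If `M` is small, then the coloured vertices are few.
    obtain ⟨col, h1, h2, -⟩ := exists_recoloring (M := M) le_rfl hcard _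
      (fun x => if x ∈ M then some (⟨0, hk⟩ : Fin k) else none) (fun x hx => by simp [hx]) rfl
    refine ⟨col, h1, h2, univ.filter (fun x => col x ≠ none), ?_, ?_⟩
    · have h3 := card_eq_sum_card_fiberwise (f := col) (s := univ) (t := univ) (by simp)
      have h4 := card_filter_add_card_filter_not (s := (univ : Finset V)) (fun x => col x = none)
      rw [Fintype.sum_option, sum_congr rfl fun i _ => h2 i, sum_const, card_univ,
        card_univ, Fintype.card_fin, smul_eq_mul] at h3
      have h5 : #{x | col x ≠ none} = k * #M := by
        change #{x | ¬ col x = none} = _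
        rw [card_univ] at h4
        omega
      rw [h5]
      nlinarith [Nat.mul_le_mul_left k hsmall.le, Nat.zero_le (k * (k + 1) * Δ)]
    · intro x hx y hy hxy
      simp only [mem_filter, mem_univ, true_and, ne_eq, not_not] at hx hy
      rw [blockGraph_adj]
      exact ⟨hxy.ne, fun _ => hx, fun h => absurd hx (h1 x h), fun h => absurd hy (h1 y h)⟩

/-! ### Stability -/

omit [DecidableRel G.Adj] in
/-- If `G` is contained in `H` up to the edges at the vertices of `B`, then the edit distance is
controlled by `|B|` and the difference of the numbers of edges. -/
lemma editDist_le [Fintype V] {H : SimpleGraph V} {B : Finset V}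
    (h : ∀ x ∉ B, ∀ y ∉ B, G.Adj x y → H.Adj x y) :
    editDist G H + G.edgeSet.ncard ≤ 2 * (#B * Fintype.card V) + H.edgeSet.ncard := by
  have h1 : (G.edgeSet \ H.edgeSet).ncard ≤ #B * Fintype.card V := by
    have hsub : G.edgeSet \ H.edgeSet ⊆
        ((B ×ˢ (univ : Finset V)).image fun p : V × V => s(p.1, p.2) : Finset (Sym2 V)) := by
      intro e
      induction e using Sym2.ind with
      | _ x y =>
        rintro ⟨hG, hH⟩
        simp only [coe_image, Set.mem_image, mem_coe, mem_product, mem_univ, and_true]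
        by_cases hx : x ∈ B
        · exact ⟨(x, y), hx, rfl⟩
        · by_cases hy : y ∈ B
          · exact ⟨(y, x), hy, Sym2.eq_swap⟩
          · exact absurd (h x hx y hy hG) hH
    refine (Set.ncard_le_ncard hsub (finite_toSet _)).trans ?_
    rw [Set.ncard_coe_finset]
    refine card_image_le.trans ?_
    rw [card_product, card_univ]
  have h2 := Set.ncard_inter_add_ncard_sdiff_eq_ncard G.edgeSet H.edgeSet
  have h3 := Set.ncard_inter_add_ncard_sdiff_eq_ncard H.edgeSet G.edgeSet
  rw [Set.inter_comm] at h3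
  have h4 : editDist G H ≤ (G.edgeSet \ H.edgeSet).ncard + (H.edgeSet \ G.edgeSet).ncard := by
    rw [editDist, Set.symmDiff_def]
    exact Set.ncard_union_le _ _
  omega

/-- A colouring with `k` classes of size `⌊n / k⌋` has fewer than `k` uncoloured vertices. By
distributing these one obtains a Turán graph. -/
lemma exists_equitable_coloring [Fintype V] {k : ℕ} (hk : 1 ≤ k) {col : V → Option (Fin k)}
    (hcol : ∀ i, #{x | col x = some i} = Fintype.card V / k) :
    ∃ col' : V → Option (Fin k), (∀ x, col' x ≠ none) ∧
      (∀ i, #{x | col' x = some i} = Fintype.card V / k ∨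
        #{x | col' x = some i} = Fintype.card V / k + 1) ∧
      (∀ x, col x ≠ none → col' x = col x) ∧ #{x | col x = none} ≤ k := by
  have h1 := card_eq_sum_card_fiberwise (f := col) (s := univ) (t := univ) (by simp)
  rw [Fintype.sum_option, sum_congr rfl fun i _ => hcol i, sum_const, card_univ, card_univ,
    Fintype.card_fin, smul_eq_mul] at h1
  have h2 := Nat.div_add_mod (Fintype.card V) k
  have h3 := Nat.mod_lt (Fintype.card V) hk
  have h4 : #{x | col x = none} ≤ k := by omega
  obtain ⟨ρ⟩ : Nonempty ({x // col x = none} ↪ Fin k) := by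
    refine Function.Embedding.nonempty_of_card_le ?_
    rwa [Fintype.card_fin, Fintype.card_subtype]
  let col' : V → Option (Fin k) := fun x => if hx : col x = none then some (ρ ⟨x, hx⟩) else col x
  have hnone : ∀ x (hx : col x = none), col' x = some (ρ ⟨x, hx⟩) := fun x hx => dif_pos hx
  have hsome : ∀ x, col x ≠ none → col' x = col x := fun x hx => dif_neg hx
  refine ⟨col', fun x => ?_, fun i => ?_, hsome, h4⟩
  · by_cases hx : col x = none
    · simp [hnone x hx]
    · rwa [hsome x hx]
  · have hle : univ.filter (fun x => col x = some i) ⊆ univ.filter (fun x => col' x = some i) := by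
      intro x hx
      have hx : col x = some i := by simpa using hx
      simp [hsome x (by simp [hx]), hx]
    have hone : #(univ.filter (fun x => col' x = some i) \ univ.filter (fun x => col x = some i))
        ≤ 1 := by
      refine card_le_one.2 fun x hx y hy => ?_
      simp only [mem_sdiff, mem_filter, mem_univ, true_and] at hx hy
      have hx' : col x = none := by
        by_contra h
        exact hx.2 (hsome x h ▸ hx.1)
      have hy' : col y = none := by
        by_contra h
        exact hy.2 (hsome y h ▸ hy.1)
      have h5 := hx.1
      rw [← hy.1, hnone x hx', hnone y hy'] at h5
      exact congrArg Subtype.val (ρ.injective (Option.some.inj h5))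
    have h6 := card_sdiff_add_card_eq_card hle
    rw [hcol i] at h6
    omega

/-- Stability with explicit error terms. -/
theorem NoCliqueMeets.exists_isTurm_editDist_le [Fintype V] {k b Δ : ℕ} (hk : 1 ≤ k) {M : Finset V}
    (hM : NoCliqueMeets G (k + 1) M) (hb : 2 * k * b ≤ Δ)
    (hE : twoTurm k (Fintype.card V) (min #M (Fintype.card V / k) : ℕ) <
      adjPairs G univ + b * Δ) :
    ∃ H : SimpleGraph V, IsTurm k #M H ∧ NoCliqueMeets H (k + 1) M ∧
      2 * editDist G H ≤
        4 * ((k * (k + 1) * ((k + 12) * Δ + 1) + k) * Fintype.card V) + b * Δ := by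
  classical
  set n := Fintype.card V with hn
  obtain ⟨M', hMM, hc⟩ := exists_subset_card_eq (min_le_left #M (n / k))
  have hle : k * #M' ≤ n := by
    rw [hc]
    exact (Nat.mul_le_mul_left k (min_le_right _ _)).trans (Nat.mul_div_le n k)
  rw [← hc] at hE
  obtain ⟨col, h1, h2, B, hB, h3⟩ := (hM.mono hMM).exists_coloring hk hle hb hE
  -- The number of edges of `H` is controlled by the upper bound.
  have hdist : ∀ (col' : V → Option (Fin k)) (B' : Finset V), (∀ x ∈ M', col' x ≠ none) →
      #B' ≤ k * (k + 1) * ((k + 12) * Δ + 1) + k →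
      (∀ x ∉ B', ∀ y ∉ B', G.Adj x y → (blockGraph col' M').Adj x y) →
      2 * editDist G (blockGraph col' M') ≤
        4 * ((k * (k + 1) * ((k + 12) * Δ + 1) + k) * n) + b * Δ := by
    intro col' B' hcol' hB' hadj
    have h4 := (noCliqueMeets_blockGraph hcol').adjPairs_le_twoTurm hk (subset_univ M')
    have h5 := editDist_le hadj
    have h6 := Nat.mul_le_mul_right n hB'
    rw [card_univ, ← hn] at h4
    rw [adjPairs_univ] at h4 hE
    rw [← hn] at h5
    zify at h4 h5 h6 ⊢
    push_cast at h4 hE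
    linarith
  rcases lt_or_ge (k * #M) n with hlt | hge
  · have hMc : #M' = #M := by
      rw [hc, min_eq_left ((Nat.le_div_iff_mul_le hk).2 (by rw [mul_comm]; exact hlt.le))]
    obtain rfl := eq_of_subset_of_card_le hMM hMc.ge
    refine ⟨blockGraph col M', ?_, noCliqueMeets_blockGraph h1, hdist col B h1 (by omega) h3⟩
    exact IsBlockColoring.isTurm rfl ⟨h1, fun i => Or.inl (h2 i), fun _ _ _ _ => Iff.rfl⟩ hlt
  · have hMc : #M' = n / k := by rw [hc, min_eq_right (Nat.div_le_of_le_mul hge)]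
    obtain ⟨col', g1, g2, g3, g4⟩ := exists_equitable_coloring hk fun i => (h2 i).trans hMc
    refine ⟨blockGraph col' M', isTurm_blockGraph_of_card_le hk hge M' g1 g2, fun Q hQ => ?_,
      hdist col' (B ∪ ({x | col x = none} : Finset V)) (fun x _ => g1 x) ?_ ?_⟩
    · have h4 := card_le_of_isClique_blockGraph hQ.isClique fun x _ => g1 x
      have h5 := hQ.card_eq
      omega
    · exact (card_union_le _ _).trans (add_le_add hB g4)
    · intro x hx y hy hxy
      simp only [notMem_union, mem_filter, mem_univ, true_and] at hx hy
      have h4 := h3 x hx.1 y hy.1 hxy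
      rw [blockGraph_adj] at h4 ⊢
      rwa [g3 x hx.2, g3 y hy.2]

end

end TuranMeet

theorem theorem3 (r : ℕ) (hr : 3 ≤ r) (ε : ℝ) (hε : 0 < ε) :
    ∃ γ : ℝ, 0 < γ ∧
      ∀ (V : Type*) [Fintype V] (n m : ℕ) (G : SimpleGraph V) (M : Finset V),
        Fintype.card V = n → M.card = m → TuranMeet.NoCliqueMeets G r M →
        (TuranMeet.turm (r - 1) n m : ℝ) - γ * (n : ℝ) ^ 2 < (G.edgeSet.ncard : ℝ) →
        ∃ H : SimpleGraph V, TuranMeet.IsTurm (r - 1) m H ∧ TuranMeet.NoCliqueMeets H r M ∧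
          (TuranMeet.editDist G H : ℝ) ≤ ε * (n : ℝ) ^ 2 := by
  obtain ⟨k, rfl⟩ : ∃ k, r = k + 1 := ⟨r - 1, by omega⟩
  have hk : 1 ≤ k := by omega
  have hk' : (1 : ℝ) ≤ k := by exact_mod_cast hk
  rw [Nat.add_sub_cancel]
  set K : ℝ := k * (k + 1) * (k + 14) with hK
  have hKpos : 0 < K := by positivity
  -- Atypical vertices are those whose degree is off by `Δ = ⌊δ n⌋`.
  set δ : ℝ := min 1 (ε / (2 * K + 1)) with hδ
  have hδpos : 0 < δ := lt_min one_pos (by positivity)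
  have hδ1 : δ ≤ 1 := min_le_left _ _
  have hδε : (2 * K + 1) * δ ≤ ε := by
    have := min_le_right 1 (ε / (2 * K + 1))
    rw [← hδ, le_div_iff₀ (by positivity)] at this
    linarith
  refine ⟨δ ^ 2 / (32 * (2 * k + 1) ^ 2), by positivity, ?_⟩
  intro V _ n m G M hn hm hM he
  classical
  subst hn hm
  set n := Fintype.card V with hn
  have hturm := TuranMeet.two_mul_turm hk n M.card
  have hE := TuranMeet.adjPairs_univ (G := G)
  set γ : ℝ := δ ^ 2 / (32 * (2 * k + 1) ^ 2) with hγ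
  have hγ' : γ * (32 * (2 * k + 1) ^ 2) = δ ^ 2 := div_mul_cancel₀ _ (by positivity)
  have hγ0 : 0 < γ := by positivity
  have hn0 : (0 : ℝ) ≤ n := Nat.cast_nonneg _
  rcases lt_or_ge (δ * n) (2 * k + 1) with hsmall | hlarge
  · -- For small `n` the hypothesis means that `G` attains the bound.
    have h1 : γ * (n : ℝ) ^ 2 < 1 := by
      have h2 : (δ * n) ^ 2 < (2 * k + 1) ^ 2 := by gcongr
      have h3 : γ * n ^ 2 * (32 * (2 * k + 1) ^ 2) < (2 * k + 1) ^ 2 := by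
        calc γ * n ^ 2 * (32 * (2 * k + 1) ^ 2) = (γ * (32 * (2 * k + 1) ^ 2)) * n ^ 2 := by ring
          _ = (δ * n) ^ 2 := by rw [hγ']; ring
          _ < _ := h2
      by_contra! h
      have h4 : (0 : ℝ) < (2 * k + 1) ^ 2 := by positivity
      nlinarith
    have h2 : TuranMeet.turm k n M.card < G.edgeSet.ncard + 1 := by
      have : (TuranMeet.turm k n M.card : ℝ) < G.edgeSet.ncard + 1 := by linarith
      exact_mod_cast this
    refine ⟨G, hM.isTurm hk ?_, hM, ?_⟩
    · rw [← hturm, hE]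
      push_cast
      linarith
    · rw [TuranMeet.editDist, symmDiff_self, Set.bot_eq_empty, Set.ncard_empty]
      push_cast
      positivity
  · set Δ : ℕ := ⌊δ * n⌋₊ with hΔ
    have hΔ1 : (Δ : ℝ) ≤ δ * n := Nat.floor_le (by positivity)
    have hΔ2 : δ * n < Δ + 1 := Nat.lt_floor_add_one _
    have hΔ3 : 2 * k ≤ Δ := by
      have : (2 * k : ℝ) < Δ + 1 := by linarith
      have : 2 * k < Δ + 1 := by exact_mod_cast this
      omega
    -- Few vertices are atypical since `b Δ` exceeds the number of missing edges.
    set b : ℕ := Δ / (2 * k) with hb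
    have hb1 : 2 * k * b ≤ Δ := Nat.mul_div_le _ _
    have hb2 : Δ ≤ 4 * k * b := by
      have h1 := Nat.lt_mul_div_succ Δ (show 0 < 2 * k by omega)
      have h2 : 1 ≤ b := (Nat.one_le_div_iff (by omega)).2 hΔ3
      rw [← hb] at h1
      nlinarith
    have hbΔ : b ≤ Δ := le_trans (Nat.le_mul_of_pos_left b (by omega)) hb1
    have hgap : 2 * (γ * (n : ℝ) ^ 2) ≤ b * Δ := by
      have h1 : δ * n ≤ 2 * Δ := by
        have : (2 * k : ℝ) ≤ Δ := by exact_mod_cast hΔ3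
        linarith
      have h2 : (δ * n) ^ 2 ≤ (2 * Δ) ^ 2 := by gcongr
      have h3 : (Δ : ℝ) ≤ 4 * k * b := by exact_mod_cast hb2
      have h4 : (Δ : ℝ) * Δ ≤ 4 * k * b * Δ := by gcongr
      have h5 : γ * n ^ 2 * (32 * (2 * k + 1) ^ 2) = (δ * n) ^ 2 := by
        calc γ * n ^ 2 * (32 * (2 * k + 1) ^ 2) = (γ * (32 * (2 * k + 1) ^ 2)) * n ^ 2 := by ring
          _ = (δ * n) ^ 2 := by rw [hγ']; ring
      have h6 : 0 ≤ γ * (n : ℝ) ^ 2 := by positivity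
      have h7 : γ * n ^ 2 * (32 * k) ≤ γ * n ^ 2 * (32 * (2 * k + 1) ^ 2) := by
        gcongr
        nlinarith
      have h8 : (16 * k : ℝ) * (2 * (γ * n ^ 2)) ≤ 16 * k * (b * Δ) := by nlinarith
      exact le_of_mul_le_mul_left h8 (by positivity)
    have hlt : TuranMeet.twoTurm k n (min M.card (n / k) : ℕ) <
        TuranMeet.adjPairs G Finset.univ + b * Δ := by
      rw [← hturm, hE]
      have : (2 * TuranMeet.turm k n M.card : ℝ) < 2 * G.edgeSet.ncard + b * Δ := by linarith
      exact_mod_cast this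
    obtain ⟨H, hH, hHM, hd⟩ := hM.exists_isTurm_editDist_le hk hb1 hlt
    refine ⟨H, hH, hHM, ?_⟩
    rw [← hn] at hd
    have hΔpos : (1 : ℝ) ≤ Δ := by exact_mod_cast (show 1 ≤ Δ by omega)
    have hcoef : (k : ℝ) * (k + 1) * ((k + 12) * Δ + 1) + k ≤ K * Δ := by
      have h1 : (k : ℝ) * (k + 1) ≤ k * (k + 1) * Δ := le_mul_of_one_le_right (by positivity) hΔpos
      have h2 : (k : ℝ) ≤ k * (k + 1) := le_mul_of_one_le_right (by positivity) (by linarith)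
      rw [hK]
      linarith
    have hΔn : (Δ : ℝ) ≤ n := hΔ1.trans (mul_le_of_le_one_left hn0 hδ1)
    have hbn : (b : ℝ) * Δ ≤ n * Δ := by
      have : (b : ℝ) ≤ Δ := by exact_mod_cast hbΔ
      exact mul_le_mul_of_nonneg_right (this.trans hΔn) (by positivity)
    have hd' : 2 * (TuranMeet.editDist G H : ℝ) ≤
        4 * (((k : ℝ) * (k + 1) * ((k + 12) * Δ + 1) + k) * n) + b * Δ := by exact_mod_cast hd
    have h1 : ((k : ℝ) * (k + 1) * ((k + 12) * Δ + 1) + k) * n ≤ K * Δ * n :=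
      mul_le_mul_of_nonneg_right hcoef hn0
    have h2 : 0 ≤ (Δ : ℝ) * n := by positivity
    calc (TuranMeet.editDist G H : ℝ) ≤ (2 * K + 1) * Δ * n := by nlinarith
      _ ≤ (2 * K + 1) * (δ * n) * n := by gcongr
      _ = ((2 * K + 1) * δ) * n ^ 2 := by ring
      _ ≤ ε * n ^ 2 := by gcongr
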